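/- **Matrix Schur recurrences.** For every integer $k\ge 0$ there is a noncommutative rational function $R_k$ with complex coefficients, in $4k$ noncommuting variables, depending only on $k$ (neither on $d$ nor on $M$), with the following property. Let $d\ge 0$ and let $M$ be a positive $d\times d$ matrix-valued Borel measure on the unit circle $\mathbb T$, normalized by $M(\mathbb T)=I_d$ and non-trivial, i.e. $\|P\|_L=\big(\mathrm{Tr}\int P\,dM\,P^*\big)^{1/2}$ and $\|P\|_R=\big(\mathrm{Tr}\int P^*\,dM\,P\big)^{1/2}$ are positive for every non-zero polynomial $P$ with $d\times d$ matrix coefficients. Let $$F(z)=\int_{\mathbb T}\frac{w+z}{w-z}\,dM(w)\qquad(|z|<1)$$ be its Herglotz function and let $f$ be its Schur function, the holomorphic function on the unit disc with $F(z)=(I_d+zf(z))(I_d-zf(z))^{-1}$. Let the Verblunsky coefficients $\alpha_n$ of $M$ be produced by the Schur algorithm: $f_0=f$, $\alpha_n=f_n(0)$, $\rho_n^L=(I_d-\alpha_n^*\alpha_n)^{1/2}$, $\rho_n^R=(I_d-\alpha_n\alpha_n^*)^{1/2}$ and $$f_{n+1}(z)=z^{-1}(\rho_n^R)^{-1}\big(f_n(z)-\alpha_n\big)\big(I_d-\alpha_n^*f_n(z)\big)^{-1}\rho_n^L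 ,$$ with the removable singularity at $z=0$ filled in. Then $f$ is well defined by the stated relation, $I_d-zf(z)$ is invertible and $f(z)^*f(z)\le I_d$ for $|z|<1$, and $f(z)=\sum_{k\ge0}s_k(f)z^k$ there; the matrices $\rho_n^L,\rho_n^R$ are positive definite, with $(\rho_n^L)^2=I_d-\alpha_n^*\alpha_n$ and $(\rho_n^R)^2=I_d-\alpha_n\alpha_n^*$; and for every $k\ge 0$ $$s_k(f)=\rho_0^R\cdots\rho_{k-1}^R\,\alpha_k\,\rho_{k-1}^L\cdots\rho_0^L+R_k\big(\alpha_j,\ \alpha_j^*,\ \rho_j^L,\ \rho_j^R\ :\ 0\le j<k\big),$$ where $R_k$ is given by a noncommutative rational expression (built from complex constants and the variables by sums, products and inverses) that has a non-empty domain and all of whose inverses exist at the indicated matrices. -/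

import Mathlib

open MeasureTheory Matrix
open scoped ComplexOrder

noncomputable section

namespace MatrixSchur

/-! ### Matrix-valued measures on the unit circle -/

/-- The unit circle carries its Borel σ-algebra. -/
instance instMeasurableSpaceCircle : MeasurableSpace Circle := borel Circle

instance instBorelSpaceCircle : BorelSpace Circle := ⟨rfl⟩

/-- A `d × d` complex matrix-valued (countably additive) measure on the unit circle. -/
abbrev MatrixMeasure (d : ℕ) := VectorMeasure Circle (Matrix (Fin d) (Fin d) ℂ)

namespace MatrixMeasure

variable {d : ℕ}

/-- `M` is positive: its value on every Borel set is a positive semidefinite matrix. -/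
def IsPositive (M : MatrixMeasure d) : Prop :=
  ∀ s : Set Circle, MeasurableSet s → (M s).PosSemidef

/-- The `(i, j)` entry of `M`, a complex measure on the circle. -/
def entry (M : MatrixMeasure d) (i j : Fin d) : ComplexMeasure Circle :=
  M.mapRange (Matrix.entryAddMonoidHom ℂ i j) (continuous_id.matrix_elem i j)

/-- The integral `∫ f dM_{ij}` of a complex function against the `(i, j)` entry of `M`. -/
def entryIntegral (M : MatrixMeasure d) (i j : Fin d) (f : Circle → ℂ) : ℂ :=
  (M.entry i j).integral f (ContinuousLinearMap.mul ℝ ℂ)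

/-- The matrix `∫ f dM g`, with entries `∑ j k, ∫ f_{ij} g_{kl} dM_{jk}`. -/
def sandwich (M : MatrixMeasure d) (f g : Circle → Matrix (Fin d) (Fin d) ℂ) :
    Matrix (Fin d) (Fin d) ℂ :=
  Matrix.of fun i l => ∑ j, ∑ k, M.entryIntegral j k fun w => f w i j * g w k l

/-- The value `∑ A_k w ^ k` at a point `w` of the circle of the matrix polynomial `∑ A_k X ^ k`. -/
def polyValue (P : Polynomial (Matrix (Fin d) (Fin d) ℂ)) (w : Circle) :
    Matrix (Fin d) (Fin d) ℂ :=
  P.sum fun k A => ((w : ℂ) ^ k) • A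

/-- `‖P‖_L = (Tr ∫ P dM P^*)^{1/2}`. -/
def normL (M : MatrixMeasure d) (P : Polynomial (Matrix (Fin d) (Fin d) ℂ)) : ℝ :=
  Real.sqrt (M.sandwich (polyValue P) (fun w => (polyValue P w)ᴴ)).trace.re

/-- `‖P‖_R = (Tr ∫ P^* dM P)^{1/2}`. -/
def normR (M : MatrixMeasure d) (P : Polynomial (Matrix (Fin d) (Fin d) ℂ)) : ℝ :=
  Real.sqrt (M.sandwich (fun w => (polyValue P w)ᴴ) (polyValue P)).trace.re

/-- `M` is non-trivial: `‖·‖_L` and `‖·‖_R` are positive definite on matrix polynomials. -/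
def IsNontrivial (M : MatrixMeasure d) : Prop :=
  ∀ P : Polynomial (Matrix (Fin d) (Fin d) ℂ), P ≠ 0 → 0 < M.normL P ∧ 0 < M.normR P

/-- The Herglotz function `F(z) = ∫ (w + z) / (w - z) dM(w)` of `M`. -/
def herglotz (M : MatrixMeasure d) (z : ℂ) : Matrix (Fin d) (Fin d) ℂ :=
  Matrix.of fun i j => M.entryIntegral i j fun w => ((w : ℂ) + z) / ((w : ℂ) - z)

end MatrixMeasure

/-! ### Schur functions and the Schur algorithm -/

section Schur

variable {d : ℕ}

/-- The matrix function `z ↦ z⁻¹ (g(z) - g(0))`, with its removable singularity at `0` filled in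
by the derivative `g'(0)`. -/
def diffQuot (g : ℂ → Matrix (Fin d) (Fin d) ℂ) (z : ℂ) : Matrix (Fin d) (Fin d) ℂ :=
  Matrix.of fun i j => dslope (fun w => g w i j) 0 z

/-- The Schur function of `M`. Since `F(0) = M(𝕋) = 1`, the relation
`F(z) = (1 + z f(z)) (1 - z f(z))⁻¹` solves to `f(z) = z⁻¹ (F(z) - 1) (F(z) + 1)⁻¹`. -/
def schurFunction (M : MatrixMeasure d) (z : ℂ) : Matrix (Fin d) (Fin d) ℂ :=
  diffQuot M.herglotz z * (M.herglotz z + 1)⁻¹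

open scoped MatrixOrder in
/-- The left defect `(1 - α^* α)^{1/2}` of a matrix. -/
def defectL (α : Matrix (Fin d) (Fin d) ℂ) : Matrix (Fin d) (Fin d) ℂ :=
  CFC.sqrt (1 - αᴴ * α)

open scoped MatrixOrder in
/-- The right defect `(1 - α α^*)^{1/2}` of a matrix. -/
def defectR (α : Matrix (Fin d) (Fin d) ℂ) : Matrix (Fin d) (Fin d) ℂ :=
  CFC.sqrt (1 - α * αᴴ)

/-- One step of the Schur algorithm: with `α = g(0)`, the function
`z⁻¹ (ρ^R)⁻¹ (g(z) - α) (1 - α^* g(z))⁻¹ ρ^L`. -/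
def schurStep (g : ℂ → Matrix (Fin d) (Fin d) ℂ) (z : ℂ) : Matrix (Fin d) (Fin d) ℂ :=
  (defectR (g 0))⁻¹ * diffQuot g z * (1 - (g 0)ᴴ * g z)⁻¹ * defectL (g 0)

/-- The Schur iterates `f_0 = f, f_1, f_2, …` of the Schur function `f` of `M`. -/
def schurIterate (M : MatrixMeasure d) : ℕ → ℂ → Matrix (Fin d) (Fin d) ℂ
  | 0 => schurFunction M
  | n + 1 => schurStep (schurIterate M n)

/-- The Verblunsky coefficients `α_n = f_n(0)` of `M`. -/
def verblunsky (M : MatrixMeasure d) (n : ℕ) : Matrix (Fin d) (Fin d) ℂ :=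
  schurIterate M n 0

/-- `ρ_n^L = (1 - α_n^* α_n)^{1/2}`. -/
def rhoL (M : MatrixMeasure d) (n : ℕ) : Matrix (Fin d) (Fin d) ℂ :=
  defectL (verblunsky M n)

/-- `ρ_n^R = (1 - α_n α_n^*)^{1/2}`. -/
def rhoR (M : MatrixMeasure d) (n : ℕ) : Matrix (Fin d) (Fin d) ℂ :=
  defectR (verblunsky M n)

/-- The `k`-th Taylor coefficient at `0` of a matrix-valued function. -/
def taylorCoeff (g : ℂ → Matrix (Fin d) (Fin d) ℂ) (k : ℕ) : Matrix (Fin d) (Fin d) ℂ :=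
  Matrix.of fun i j => iteratedDeriv k (fun w => g w i j) 0 / (k.factorial : ℂ)

end Schur

/-! ### Noncommutative rational functions -/

/-- Noncommutative rational expressions with complex coefficients in the letters `σ`. -/
inductive NCRatExpr (σ : Type) : Type
  | const (c : ℂ) : NCRatExpr σ
  | var (x : σ) : NCRatExpr σ
  | add (r s : NCRatExpr σ) : NCRatExpr σ
  | mul (r s : NCRatExpr σ) : NCRatExpr σ
  | inv (r : NCRatExpr σ) : NCRatExpr σ

namespace NCRatExpr

variable {σ : Type} {d : ℕ}

/-- The value of an expression at a tuple of `d × d` matrices; meaningful on its domain. -/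
def eval (X : σ → Matrix (Fin d) (Fin d) ℂ) : NCRatExpr σ → Matrix (Fin d) (Fin d) ℂ
  | const c => c • (1 : Matrix (Fin d) (Fin d) ℂ)
  | var x => X x
  | add r s => eval X r + eval X s
  | mul r s => eval X r * eval X s
  | inv r => (eval X r)⁻¹

/-- The tuple `X` lies in the domain of the expression: every inverse that occurs in it is the
inverse of an invertible matrix. -/
def DefinedAt (X : σ → Matrix (Fin d) (Fin d) ℂ) : NCRatExpr σ → Prop
  | const _ => True
  | var _ => True
  | add r s => DefinedAt X r ∧ DefinedAt X s
  | mul r s => DefinedAt X r ∧ DefinedAt X s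
  | inv r => DefinedAt X r ∧ IsUnit (eval X r)

/-- The expression represents a noncommutative rational function: its domain is non-empty at some
positive matrix size. -/
def Nondegenerate (r : NCRatExpr σ) : Prop :=
  ∃ (n : ℕ) (X : σ → Matrix (Fin n) (Fin n) ℂ), 0 < n ∧ r.DefinedAt X

end NCRatExpr

/-- The letters `α_j, α_j^*, ρ_j^L, ρ_j^R` for `0 ≤ j < k`. -/
inductive Letter (k : ℕ) : Type
  | alpha (j : Fin k) : Letter k
  | alphaStar (j : Fin k) : Letter k
  | rhoL (j : Fin k) : Letter k
  | rhoR (j : Fin k) : Letter k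

/-- The matrices that the letters stand for, given the Verblunsky coefficients of `M`. -/
def letterValue {d : ℕ} (M : MatrixMeasure d) {k : ℕ} : Letter k → Matrix (Fin d) (Fin d) ℂ
  | .alpha j => verblunsky M j
  | .alphaStar j => (verblunsky M j)ᴴ
  | .rhoL j => rhoL M j
  | .rhoR j => rhoR M j

end MatrixSchur

end

/-!
The argument rests on three observations, each of which works with moments and Taylor coefficients
only.

*The Schur function.* Non-triviality makes `∫ P^* dM P` positive for every matrix polynomial `P`.
Taking for `P` the partial sums of `(1 - z̄ w)⁻¹ V` and passing to the limit shows that `F + F^*`, the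
integral of twice the Poisson kernel, is positive semidefinite on the disc
(`posSemidef_herglotz_add_conjTranspose`). Hence `F + 1` is invertible, its Cayley transform
`z f(z) = (F - 1) (F + 1)⁻¹` is contractive, and Schwarz' lemma gives `‖f‖ ≤ 1`
(`norm_schurFunction_le`).

*The Schur algorithm does not stop.* Let `φ` be the Taylor series of a Schur iterate, and suppose
that `φ p = q` up to order `N` for matrix polynomials `p`, `q` of degree less than `N`. If `φ` is the
Schur transform of `ψ`, then a constant matrix, which preserves the indefinite form
`∑ (p_i^* p_i - q_i^* q_i)`, carries `(p, z q)` to a pair on the graph of `ψ` up to order `N + 1`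
(`IsGraphPair.descend`). Once `f` is reached, the relation `F (1 - z f) = 1 + z f` turns the trace of
the form into the squared norm in `L²(M)` of the polynomial `p - z q`, and this is positive
(`IsGraphPair.trace_gramDiff_pos`). Starting from the constants `p = V` and `q = α_n V`, for which
the form is `V^* (1 - α_n^* α_n) V`, one finds that `1 - α_n^* α_n` is positive definite
(`posDef_one_sub_verblunsky`). No boundary behaviour of the iterates is needed, only their germs at
`0`.

*The recurrences.* Cleared of the inverse of `1 - α^* g`, the Schur step expresses
`s_{k+1}(f_n)` as `ρ_n^R s_k(f_{n+1}) ρ_n^L` minus products of lower coefficients of `f_n` and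
`f_{n+1}` with `α_n^*`, `(ρ_n^R)⁻¹` and `ρ_n^L` (`taylorCoeff_succ`). The first term carries the
leading term of `f_{n+1}` to that of `f_n`, and strong induction on `k` shows that the remainder is
given by one noncommutative rational expression for all measures
(`isNCRational_taylorCoeff_sub_leadingTerm`), whose only inverses are those of the `ρ_j^R`.
-/

namespace MatrixSchur

open Filter Topology

/-! ### Integration against a complex measure -/

section ComplexMeasure

variable {X : Type*} [MeasurableSpace X]

/-- A complex measure has finite total variation, being dominated by the variations of its real
and imaginary parts. -/
instance isFiniteMeasure_variation (μ : ComplexMeasure X) : IsFiniteMeasure μ.variation := by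
  have h : μ.variation ≤ (ComplexMeasure.re μ).variation + (ComplexMeasure.im μ).variation := by
    refine VectorMeasure.variation_le_of_forall_enorm_le fun s _ => ?_
    calc ‖μ s‖ₑ = ‖(((μ s).re : ℝ) : ℂ) + ((μ s).im : ℝ) * Complex.I‖ₑ := by
          rw [Complex.re_add_im]
      _ ≤ ‖(((μ s).re : ℝ) : ℂ)‖ₑ + ‖(((μ s).im : ℝ) : ℂ) * Complex.I‖ₑ := enorm_add_le _ _
      _ = ‖(ComplexMeasure.re μ) s‖ₑ + ‖(ComplexMeasure.im μ) s‖ₑ := by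
          congr 1 <;> simp [← ofReal_norm] <;> rfl
      _ ≤ _ := add_le_add (VectorMeasure.enorm_measure_le_variation _ _)
          (VectorMeasure.enorm_measure_le_variation _ _)
  rw [← SignedMeasure.totalVariation_eq_variation, ← SignedMeasure.totalVariation_eq_variation] at h
  have h1 : IsFiniteMeasure (ComplexMeasure.re μ).totalVariation := by
    unfold SignedMeasure.totalVariation; infer_instance
  have h2 : IsFiniteMeasure (ComplexMeasure.im μ).totalVariation := by
    unfold SignedMeasure.totalVariation; infer_instance
  exact isFiniteMeasure_of_le _ h

/-- The pairing integral of a complex function against a complex measure is complex linear. -/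
theorem integral_const_mul (μ : ComplexMeasure X) (c : ℂ) (f : X → ℂ) :
    μ.integral (fun x => c * f x) (ContinuousLinearMap.mul ℝ ℂ) =
      c * μ.integral f (ContinuousLinearMap.mul ℝ ℂ) :=
  setToFun_smul _ (fun c s x => mul_assoc c x (μ s)) c f

theorem star_integral (μ ν : ComplexMeasure X) (h : ∀ s, ν s = star (μ s)) {f : X → ℂ}
    (hf : Integrable f μ.variation) :
    star (μ.integral f (ContinuousLinearMap.mul ℝ ℂ)) =
      ν.integral (fun x => star (f x)) (ContinuousLinearMap.mul ℝ ℂ) := by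
  have hv : ν.variation = μ.variation := by
    apply le_antisymm
    · refine VectorMeasure.variation_le_of_forall_enorm_le fun s _ => ?_
      rw [h, ← ofReal_norm, norm_star, ofReal_norm]
      exact VectorMeasure.enorm_measure_le_variation _ _
    · refine VectorMeasure.variation_le_of_forall_enorm_le fun s _ => ?_
      rw [← ofReal_norm, ← norm_star, ← h, ofReal_norm]
      exact VectorMeasure.enorm_measure_le_variation _ _
  refine hf.induction (P := fun f => star (μ.integral f (ContinuousLinearMap.mul ℝ ℂ)) =
      ν.integral (fun x => star (f x)) (ContinuousLinearMap.mul ℝ ℂ)) ?_ ?_ ?_ ?_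
  · intro c s hs hc
    have : (fun x => star (s.indicator (fun _ => c) x)) = s.indicator fun _ => star c := by
      ext x
      by_cases hx : x ∈ s <;> simp [hx]
    rw [this, VectorMeasure.integral_indicator_const _ hs,
      VectorMeasure.integral_indicator_const _ hs]
    simp [h]
  · intro f g _ hf hg h1 h2
    have e : (fun x => star ((f + g) x)) = fun x => star (f x) + star (g x) := by
      ext x; simp
    rw [e, VectorMeasure.integral_fun_add, ← h1, ← h2, ← star_add]
    · congr 1
      exact VectorMeasure.integral_fun_add hf hg
    · rw [VectorMeasure.Integrable, hv]
      exact (Complex.conjCLE : ℂ →L[ℝ] ℂ).integrable_comp hf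
    · rw [VectorMeasure.Integrable, hv]
      exact (Complex.conjCLE : ℂ →L[ℝ] ℂ).integrable_comp hg
  · apply isClosed_eq
    · exact continuous_star.comp VectorMeasure.continuous_integral
    · have I (f : Lp ℂ 1 μ.variation) :
          ν.integral (fun x => star (f x)) (ContinuousLinearMap.mul ℝ ℂ) =
          ν.integral ((Complex.conjCLE : ℂ →L[ℝ] ℂ).compLp f) (ContinuousLinearMap.mul ℝ ℂ) := by
        apply VectorMeasure.integral_congr_ae
        rw [hv]
        filter_upwards [ContinuousLinearMap.coeFn_compLp (Complex.conjCLE : ℂ →L[ℝ] ℂ) f] with x hx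
        exact hx.symm
      simp_rw [I]
      have hc : Continuous fun f : Lp ℂ 1 ν.variation =>
          ν.integral f (ContinuousLinearMap.mul ℝ ℂ) := VectorMeasure.continuous_integral
      rw [hv] at hc
      exact hc.comp ((Complex.conjCLE : ℂ →L[ℝ] ℂ).compLpL 1 μ.variation).continuous
  · intro f g hfg _ hf
    rw [← VectorMeasure.integral_congr_ae hfg, hf]
    apply VectorMeasure.integral_congr_ae
    rw [hv]
    filter_upwards [hfg] with x hx
    rw [hx]

end ComplexMeasure

/-! ### Moments of a matrix measure and its Herglotz function -/

namespace MatrixMeasure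

variable {d : ℕ} (M : MatrixMeasure d)

theorem integrable_of_continuous (μ : ComplexMeasure Circle) {f : Circle → ℂ} (hf : Continuous f) :
    Integrable f μ.variation := by
  obtain ⟨C, hC⟩ := (isCompact_range hf).isBounded.exists_norm_le
  exact Integrable.of_bound hf.aestronglyMeasurable C (.of_forall fun x => hC _ ⟨x, rfl⟩)

theorem entryIntegral_const_mul (i j : Fin d) (c : ℂ) (f : Circle → ℂ) :
    M.entryIntegral i j (fun w => c * f w) = c * M.entryIntegral i j f :=
  integral_const_mul _ c f

theorem entryIntegral_add (i j : Fin d) {f g : Circle → ℂ} (hf : Continuous f)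
    (hg : Continuous g) :
    M.entryIntegral i j (fun w => f w + g w) = M.entryIntegral i j f + M.entryIntegral i j g :=
  VectorMeasure.integral_fun_add (integrable_of_continuous _ hf) (integrable_of_continuous _ hg)

theorem entryIntegral_sum (i j : Fin d) {ι : Type*} (s : Finset ι) {f : ι → Circle → ℂ}
    (hf : ∀ a ∈ s, Continuous (f a)) :
    M.entryIntegral i j (fun w => ∑ a ∈ s, f a w) = ∑ a ∈ s, M.entryIntegral i j (f a) :=
  VectorMeasure.integral_finsetSum s fun a ha => integrable_of_continuous _ (hf a ha)

theorem IsPositive.star_entryIntegral {M : MatrixMeasure d} (hM : M.IsPositive) (i j : Fin d)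
    {f : Circle → ℂ} (hf : Continuous f) :
    star (M.entryIntegral i j f) = M.entryIntegral j i fun w => star (f w) := by
  refine star_integral _ _ (fun s => ?_) (integrable_of_continuous _ hf)
  by_cases hs : MeasurableSet s
  · exact ((hM s hs).isHermitian.apply j i).symm
  · rw [VectorMeasure.not_measurable _ hs, VectorMeasure.not_measurable _ hs, star_zero]

theorem hasSum_entryIntegral (i j : Fin d) {F : ℕ → Circle → ℂ} {f : Circle → ℂ} {b : ℕ → ℝ}
    (hF : ∀ n, Continuous (F n)) (hb : Summable b) (hFb : ∀ n w, ‖F n w‖ ≤ b n)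
    (hf : ∀ w, HasSum (fun n => F n w) (f w)) :
    HasSum (fun n => M.entryIntegral i j (F n)) (M.entryIntegral i j f) :=
  VectorMeasure.hasSum_integral_of_dominated_convergence (fun n _ => b n)
    (fun n => (hF n).aestronglyMeasurable) (fun n => .of_forall (hFb n)) (.of_forall fun _ => hb)
    (integrable_const _) (.of_forall hf)

/-- The moment `∫ w ^ n dM(w)`, for an integer `n`. -/
noncomputable def moment (n : ℤ) : Matrix (Fin d) (Fin d) ℂ :=
  Matrix.of fun i j => M.entryIntegral i j fun w => (w : ℂ) ^ n

theorem continuous_coe_zpow (n : ℤ) : Continuous fun w : Circle => (w : ℂ) ^ n :=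
  continuous_subtype_val.zpow₀ n fun w => Or.inl (Circle.coe_ne_zero w)

theorem moment_zero (h1 : M Set.univ = 1) : M.moment 0 = 1 := by
  ext i j
  have : M.entryIntegral i j (fun w : Circle => (w : ℂ) ^ (0 : ℤ)) = M Set.univ i j := by
    simp only [zpow_zero, entryIntegral]
    rw [VectorMeasure.integral_const]
    exact one_mul _
  rw [moment, Matrix.of_apply, this, h1]

theorem IsPositive.moment_neg {M : MatrixMeasure d} (hM : M.IsPositive) (n : ℤ) :
    M.moment (-n) = (M.moment n)ᴴ := by
  ext i j
  rw [conjTranspose_apply, moment, moment, of_apply, of_apply,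
    hM.star_entryIntegral _ _ (continuous_coe_zpow n)]
  congr 1
  ext w
  rw [_root_.zpow_neg, star_zpow₀, ← _root_.inv_zpow, ← Circle.coe_inv, Circle.coe_inv_eq_conj]
  rfl

/-- The Taylor coefficients of the Herglotz function; the one of order `0` is `M(𝕋) = 1`. -/
noncomputable def herglotzCoeff (n : ℕ) : Matrix (Fin d) (Fin d) ℂ :=
  if n = 0 then 1 else (2 : ℂ) • M.moment (-n)

theorem sub_ne_zero_of_norm_lt (w : Circle) {z : ℂ} (hz : ‖z‖ < 1) : (w : ℂ) - z ≠ 0 := by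
  intro h
  rw [← sub_eq_zero.1 h, Circle.norm_coe] at hz
  exact lt_irrefl _ hz

theorem continuous_herglotz_kernel {z : ℂ} (hz : ‖z‖ < 1) :
    Continuous fun w : Circle => ((w : ℂ) + z) / ((w : ℂ) - z) :=
  (continuous_subtype_val.add continuous_const).div (continuous_subtype_val.sub continuous_const)
    fun w => sub_ne_zero_of_norm_lt w hz

theorem hasSum_herglotz (h1 : M Set.univ = 1) {z : ℂ} (hz : ‖z‖ < 1) (i j : Fin d) :
    HasSum (fun n => z ^ n * M.herglotzCoeff n i j) (M.herglotz z i j) := by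
  have key : HasSum (fun n : ℕ => M.entryIntegral i j
      fun w => (if n = 0 then 1 else 2 * z ^ n) * (w : ℂ) ^ (-n : ℤ)) (M.herglotz z i j) := by
    refine M.hasSum_entryIntegral i j (b := fun n => 2 * ‖z‖ ^ n)
      (fun n => continuous_const.mul (continuous_coe_zpow _))
      ((summable_geometric_of_lt_one (norm_nonneg z) hz).mul_left 2) (fun n w => ?_) fun w => ?_
    · rw [norm_mul, norm_zpow, Circle.norm_coe, _root_.one_zpow, mul_one]
      split_ifs with h <;> simp [h]
    · have hw : (w : ℂ) ≠ 0 := (Circle.coe_ne_zero w)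
      have hwz := sub_ne_zero_of_norm_lt w hz
      have hq : ‖z / w‖ < 1 := by rwa [norm_div, Circle.norm_coe, div_one]
      have := ((hasSum_geometric_of_norm_lt_one hq).mul_left 2).sub
        (hasSum_ite_eq (0 : ℕ) (1 : ℂ))
      have hd : (1 - z / w : ℂ) ≠ 0 := by
        rw [one_sub_div hw]; exact div_ne_zero hwz hw
      have e1 : (fun n : ℕ => (if n = 0 then 1 else 2 * z ^ n) * (w : ℂ) ^ (-n : ℤ)) =
          fun b : ℕ => 2 * (z / w) ^ b - if b = 0 then 1 else 0 := by
        ext n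
        rcases eq_or_ne n 0 with rfl | hn
        · norm_num
        · simp only [hn, if_false, div_pow, _root_.zpow_neg, zpow_natCast]
          ring
      have e2 : ((w : ℂ) + z) / ((w : ℂ) - z) = 2 * (1 - z / w)⁻¹ - 1 := by
        rw [one_sub_div hw, inv_div]
        field_simp
        ring
      rw [e1, e2]
      exact this
  convert key using 2 with n
  rw [entryIntegral_const_mul, herglotzCoeff]
  rcases eq_or_ne n 0 with rfl | hn
  · have := congrFun (congrFun (M.moment_zero h1) i) j
    simp only [moment, of_apply] at this
    simpa using this.symm
  · simp [hn, moment]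
    ring

/-- The quadratic form of matrix polynomials in terms of the Toeplitz matrix of the moments. -/
theorem sandwich_polyValue (P : Polynomial (Matrix (Fin d) (Fin d) ℂ)) {N : ℕ}
    (hN : P.natDegree < N) :
    M.sandwich (fun w => (polyValue P w)ᴴ) (polyValue P) =
      ∑ a ∈ Finset.range N, ∑ b ∈ Finset.range N,
        (P.coeff a)ᴴ * M.moment (b - a) * P.coeff b := by
  have hP (w : Circle) (i j : Fin d) :
      polyValue P w i j = ∑ a ∈ Finset.range N, (w : ℂ) ^ a * P.coeff a i j := by
    rw [polyValue, Polynomial.sum_over_range' P (by simp) N hN, Matrix.sum_apply]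
    rfl
  ext i l
  have hI (j k : Fin d) : M.entryIntegral j k (fun w => star (polyValue P w j i) *
      polyValue P w k l) = ∑ a ∈ Finset.range N, ∑ b ∈ Finset.range N,
        star (P.coeff a j i) * M.moment (b - a) j k * P.coeff b k l := by
    have : (fun w : Circle => star (polyValue P w j i) * polyValue P w k l) =
        fun w : Circle => ∑ a ∈ Finset.range N, ∑ b ∈ Finset.range N,
          (star (P.coeff a j i) * P.coeff b k l) * (w : ℂ) ^ ((b : ℤ) - a) := by
      ext w
      rw [hP, hP, star_sum, Finset.sum_mul_sum]
      refine Finset.sum_congr rfl fun a _ => Finset.sum_congr rfl fun b _ => ?_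
      have : star ((w : ℂ) ^ a) = ((w : ℂ) ^ a)⁻¹ := by
        rw [star_pow, ← inv_pow, ← Circle.coe_inv, Circle.coe_inv_eq_conj]
        rfl
      rw [star_mul', this, zpow_sub₀ (Circle.coe_ne_zero w), zpow_natCast, zpow_natCast]
      ring
    have hc (a b : ℕ) : Continuous fun w : Circle =>
        (star (P.coeff a j i) * P.coeff b k l) * (w : ℂ) ^ ((b : ℤ) - a) :=
      continuous_const.mul (continuous_coe_zpow _)
    rw [this, entryIntegral_sum _ _ _ _ fun a _ => continuous_finsetSum _ fun b _ => hc a b]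
    refine Finset.sum_congr rfl fun a _ => ?_
    rw [entryIntegral_sum _ _ _ _ fun b _ => hc a b]
    refine Finset.sum_congr rfl fun b _ => ?_
    rw [entryIntegral_const_mul, moment, of_apply]
    ring
  simp only [sandwich, of_apply, conjTranspose_apply, hI, Matrix.sum_apply, mul_apply,
    Finset.sum_mul]
  rw [Finset.sum_comm]
  rw [Finset.sum_congr rfl fun k _ => Finset.sum_comm]
  rw [Finset.sum_comm]
  refine Finset.sum_congr rfl fun a _ => ?_
  rw [Finset.sum_congr rfl fun k _ => Finset.sum_comm]
  rw [Finset.sum_comm]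

/-- The squared right norm of a non-zero matrix polynomial is positive. -/
theorem IsNontrivial.trace_sandwich_pos {M : MatrixMeasure d} (hM : M.IsNontrivial)
    {P : Polynomial (Matrix (Fin d) (Fin d) ℂ)} (hP : P ≠ 0) :
    0 < (M.sandwich (fun w => (polyValue P w)ᴴ) (polyValue P)).trace.re :=
  Real.sqrt_pos.1 (hM P hP).2

end MatrixMeasure

/-! ### Positivity through traces -/

section Trace

variable {d : ℕ}

/-- A matrix with a given vector as one column and zeros elsewhere turns the trace of a conjugated
matrix into its quadratic form. -/
theorem trace_vecMulVec_single (A : Matrix (Fin d) (Fin d) ℂ) (v : Fin d → ℂ) (i : Fin d) :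
    ((vecMulVec v (Pi.single i 1))ᴴ * A * vecMulVec v (Pi.single i 1)).trace =
      star v ⬝ᵥ A *ᵥ v := by
  have h1 : (vecMulVec v (Pi.single i (1 : ℂ)))ᴴ = vecMulVec (Pi.single i 1) (star v) := by
    rw [conjTranspose_vecMulVec]
    congr 1
    ext j
    by_cases h : j = i
    · subst h; simp
    · simp [h]
  rw [h1, Matrix.mul_assoc, Matrix.trace_mul_comm, Matrix.mul_assoc, vecMulVec_mul_vecMulVec,
    mul_vecMulVec, trace_vecMulVec]
  simp [dotProduct_comm]

theorem posSemidef_of_trace_nonneg {A : Matrix (Fin d) (Fin d) ℂ} (hA : A.IsHermitian)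
    (h : ∀ V : Matrix (Fin d) (Fin d) ℂ, 0 ≤ (Vᴴ * A * V).trace.re) : A.PosSemidef := by
  refine .of_dotProduct_mulVec_nonneg hA fun v => ?_
  rcases isEmpty_or_nonempty (Fin d) with he | ⟨⟨i⟩⟩
  · simp [dotProduct]
  · have := h (vecMulVec v (Pi.single i 1))
    rw [trace_vecMulVec_single] at this
    exact Complex.nonneg_iff.2 ⟨this, (hA.im_star_dotProduct_mulVec_self v).symm⟩

theorem posDef_of_trace_pos {A : Matrix (Fin d) (Fin d) ℂ} (hA : A.IsHermitian)
    (h : ∀ V : Matrix (Fin d) (Fin d) ℂ, V ≠ 0 → 0 < (Vᴴ * A * V).trace.re) : A.PosDef := by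
  refine .of_dotProduct_mulVec_pos hA fun v hv => ?_
  obtain ⟨i, hi⟩ := Function.ne_iff.1 hv
  have := h (vecMulVec v (Pi.single i 1)) fun h0 => hi (by simpa [vecMulVec_apply] using congrFun (congrFun h0 i) i)
  rw [trace_vecMulVec_single] at this
  exact Complex.pos_iff.2 ⟨this, (hA.im_star_dotProduct_mulVec_self v).symm⟩

end Trace

/-! ### Positivity of the real part of the Herglotz function -/

namespace MatrixMeasure

variable {d : ℕ} {M : MatrixMeasure d}

theorem norm_star_mul_coe {z : ℂ} (w : Circle) : ‖star z * (w : ℂ)‖ = ‖z‖ := by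
  rw [norm_mul, norm_star, Circle.norm_coe, mul_one]

theorem one_sub_star_mul_ne_zero {z : ℂ} (hz : ‖z‖ < 1) (w : Circle) :
    1 - star z * (w : ℂ) ≠ 0 := by
  intro h
  have := norm_star_mul_coe (z := z) w
  rw [← sub_eq_zero.1 h, norm_one] at this
  exact hz.ne this.symm

/-- Integrals of the squared modulus of the partial geometric sums `∑ (z̄ w) ^ n` converge to the
integral of the squared modulus of `(1 - z̄ w)⁻¹`. -/
theorem tendsto_entryIntegral_geom {z : ℂ} (hz : ‖z‖ < 1) (i j : Fin d) :
    Tendsto (fun N : ℕ => M.entryIntegral i j fun w =>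
        star (∑ n ∈ Finset.range N, (star z * w) ^ n) * ∑ n ∈ Finset.range N, (star z * w) ^ n)
      atTop (𝓝 (M.entryIntegral i j fun w =>
        star (1 - star z * (w : ℂ))⁻¹ * (1 - star z * (w : ℂ))⁻¹)) := by
  have hb (N : ℕ) (w : Circle) :
      ‖∑ n ∈ Finset.range N, (star z * (w : ℂ)) ^ n‖ ≤ (1 - ‖z‖)⁻¹ := by
    calc _ ≤ ∑ n ∈ Finset.range N, ‖z‖ ^ n := by
          refine (norm_sum_le _ _).trans_eq (Finset.sum_congr rfl fun n _ => ?_)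
          rw [norm_pow, norm_star_mul_coe]
      _ ≤ _ := by
          rw [← tsum_geometric_of_lt_one (norm_nonneg z) hz]
          exact (summable_geometric_of_lt_one (norm_nonneg z) hz).sum_le_tsum _
            fun n _ => by positivity
  refine VectorMeasure.tendsto_integral_of_dominated_convergence
    (fun _ => (1 - ‖z‖)⁻¹ * (1 - ‖z‖)⁻¹) (fun N => ?_) (integrable_const _)
    (fun N => .of_forall fun w => ?_) (.of_forall fun w => ?_)
  · refine Continuous.aestronglyMeasurable ?_
    have : Continuous fun w : Circle => ∑ n ∈ Finset.range N, (star z * (w : ℂ)) ^ n :=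
      continuous_finsetSum _ fun n _ => (continuous_const.mul continuous_subtype_val).pow n
    exact this.star.mul this
  · rw [norm_mul, norm_star]
    exact mul_le_mul (hb N w) (hb N w) (norm_nonneg _) ((norm_nonneg _).trans (hb N w))
  · have : Tendsto (fun N => ∑ n ∈ Finset.range N, (star z * (w : ℂ)) ^ n) atTop
        (𝓝 (1 - star z * (w : ℂ))⁻¹) :=
      (hasSum_geometric_of_norm_lt_one (by rwa [norm_star_mul_coe])).tendsto_sum_nat
    exact this.star.mul this

/-- `F + F^*` is the integral of twice the Poisson kernel, written as a multiple of
`|1 - z̄ w|⁻²`. -/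
theorem IsPositive.herglotz_add_conjTranspose (hM : M.IsPositive) {z : ℂ} (hz : ‖z‖ < 1)
    (i j : Fin d) :
    (M.herglotz z + (M.herglotz z)ᴴ) i j = 2 * (1 - (‖z‖ : ℂ) ^ 2) * M.entryIntegral i j fun w =>
      star (1 - star z * (w : ℂ))⁻¹ * (1 - star z * (w : ℂ))⁻¹ := by
  have hc := continuous_herglotz_kernel hz
  rw [Matrix.add_apply, conjTranspose_apply, herglotz, of_apply, of_apply, hM.star_entryIntegral _ _ hc,
    ← entryIntegral_add _ _ _ hc hc.star, ← entryIntegral_const_mul]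
  congr 1
  ext w
  have hw := Circle.coe_ne_zero w
  have hwz := sub_ne_zero_of_norm_lt w hz
  have hk := one_sub_star_mul_ne_zero hz w
  have hs : star (w : ℂ) = (w : ℂ)⁻¹ := by
    rw [← Circle.coe_inv, Circle.coe_inv_eq_conj]; rfl
  have hn : (‖z‖ : ℂ) ^ 2 = z * star z := (Complex.mul_conj' z).symm
  have hwz' : (1 - z * (w : ℂ)⁻¹) ≠ 0 := by
    rw [← div_eq_mul_inv, one_sub_div hw]; exact div_ne_zero hwz hw
  have hk' : (w : ℂ)⁻¹ - star z ≠ 0 := by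
    have : (w : ℂ)⁻¹ - star z = (1 - star z * w) * (w : ℂ)⁻¹ := by field_simp
    rw [this]; exact mul_ne_zero hk (inv_ne_zero hw)
  simp only [star_div₀, star_inv₀, star_add, star_sub, star_mul', star_star, star_one, hs, hn]
  generalize star z = y at *
  have e1 : (w : ℂ) - z = (1 - z * (w : ℂ)⁻¹) * w := by field_simp
  have e2 : (w : ℂ)⁻¹ - y = (1 - y * w) * (w : ℂ)⁻¹ := by field_simp
  have hk2 : 1 - (w : ℂ) * y ≠ 0 := by rwa [mul_comm]
  rw [e1, e2]
  field_simp
  ring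

theorem posSemidef_herglotz_add_conjTranspose (hM : M.IsPositive) (hnt : M.IsNontrivial) {z : ℂ}
    (hz : ‖z‖ < 1) : (M.herglotz z + (M.herglotz z)ᴴ).PosSemidef := by
  refine posSemidef_of_trace_nonneg (by
    rw [IsHermitian, conjTranspose_add, conjTranspose_conjTranspose, add_comm]) fun V => ?_
  rcases eq_or_ne V 0 with rfl | hV
  · simp
  -- the partial sums of `(1 - z̄ w)⁻¹ V`, whose norms are non-negative by non-triviality
  let P (N : ℕ) : Polynomial (Matrix (Fin d) (Fin d) ℂ) :=
    ∑ n ∈ Finset.range N, Polynomial.monomial n (star z ^ n • V)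
  have hPc (N n : ℕ) : (P N).coeff n = if n < N then star z ^ n • V else 0 := by
    simp [P, Polynomial.finsetSum_coeff, Polynomial.coeff_monomial]
  have hPv (N : ℕ) (w : Circle) :
      polyValue (P N) w = (∑ n ∈ Finset.range N, (star z * (w : ℂ)) ^ n) • V := by
    have hdeg : (P N).natDegree < N + 1 := by
      refine Nat.lt_succ_of_le (Polynomial.natDegree_le_iff_coeff_eq_zero.2 fun n hn => ?_)
      rw [hPc, if_neg (by omega)]
    rw [polyValue, Polynomial.sum_over_range' _ (by simp) _ hdeg, Finset.sum_range_succ, hPc,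
      if_neg (lt_irrefl N), smul_zero, add_zero, Finset.sum_smul]
    refine Finset.sum_congr rfl fun n hn => ?_
    rw [hPc, if_pos (Finset.mem_range.1 hn), smul_smul, mul_pow, mul_comm]
  have htr (N : ℕ) : (M.sandwich (fun w => (polyValue (P N) w)ᴴ) (polyValue (P N))).trace =
      ∑ i, ∑ j, ∑ k, (star (V j i) * V k i) * M.entryIntegral j k fun w =>
        star (∑ n ∈ Finset.range N, (star z * w) ^ n) *
          ∑ n ∈ Finset.range N, (star z * w) ^ n := by
    simp only [trace, diag_apply, sandwich, of_apply, conjTranspose_apply, hPv, Matrix.smul_apply,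
      smul_eq_mul, ← entryIntegral_const_mul]
    refine Finset.sum_congr rfl fun i _ => Finset.sum_congr rfl fun j _ =>
      Finset.sum_congr rfl fun k _ => ?_
    congr 1
    ext w
    rw [star_mul']
    ring
  have hlim := tendsto_finsetSum Finset.univ fun i _ => tendsto_finsetSum Finset.univ fun j _ =>
    tendsto_finsetSum Finset.univ fun k _ =>
      (tendsto_entryIntegral_geom (M := M) hz j k).const_mul (star (V j i) * V k i)
  simp only [← htr] at hlim
  have hnn : ∀ᶠ N in atTop,
      0 ≤ (M.sandwich (fun w => (polyValue (P N) w)ᴴ) (polyValue (P N))).trace.re := by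
    filter_upwards [eventually_gt_atTop 0] with N hN
    refine (hnt.trace_sandwich_pos fun h0 => hV ?_).le
    have := hPc N 0
    rw [h0, if_pos hN] at this
    simpa using this.symm
  have hge := ge_of_tendsto ((Complex.continuous_re.tendsto _).comp hlim) hnn
  have hfac : (Vᴴ * (M.herglotz z + (M.herglotz z)ᴴ) * V).trace =
      ((2 * (1 - ‖z‖ ^ 2) : ℝ) : ℂ) *
        ∑ i, ∑ j, ∑ k, (star (V j i) * V k i) * M.entryIntegral j k fun w =>
          star (1 - star z * (w : ℂ))⁻¹ * (1 - star z * (w : ℂ))⁻¹ := by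
    simp only [trace, diag_apply, mul_apply, conjTranspose_apply, Finset.sum_mul, Finset.mul_sum,
      hM.herglotz_add_conjTranspose hz]
    refine Finset.sum_congr rfl fun i _ => ?_
    rw [Finset.sum_comm]
    refine Finset.sum_congr rfl fun j _ => Finset.sum_congr rfl fun k _ => ?_
    push_cast
    ring
  rw [hfac, Complex.re_ofReal_mul]
  refine mul_nonneg ?_ hge
  nlinarith [norm_nonneg z]

end MatrixMeasure

/-! ### Taylor series of matrix functions -/

section Taylor

open scoped Matrix.Norms.L2Operator

variable {d : ℕ}

theorem analyticAt_matrix_iff {g : ℂ → Matrix (Fin d) (Fin d) ℂ} {c : ℂ} :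
    AnalyticAt ℂ g c ↔ ∀ i j, AnalyticAt ℂ (fun z => g z i j) c := by
  constructor
  · intro h i j
    exact ((Matrix.entryLinearMap ℂ ℂ i j).toContinuousLinearMap.analyticAt (g c)).comp h
  · intro h
    have : g = fun z => ∑ i, ∑ j, g z i j • Matrix.single i j (1 : ℂ) := by
      ext1 z
      conv_lhs => rw [Matrix.matrix_eq_sum_single (g z)]
      simp
    rw [this]
    exact Finset.analyticAt_fun_sum _ fun i _ => Finset.analyticAt_fun_sum _ fun j _ =>
      (h i j).smul analyticAt_const

theorem AnalyticAt.diffQuot {g : ℂ → Matrix (Fin d) (Fin d) ℂ} {c : ℂ} (h0 : AnalyticAt ℂ g 0)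
    (hc : AnalyticAt ℂ g c) : AnalyticAt ℂ (diffQuot g) c := by
  rw [analyticAt_matrix_iff] at *
  intro i j
  change AnalyticAt ℂ (dslope (fun w => g w i j) 0) c
  rcases eq_or_ne c 0 with rfl | hc0
  · obtain ⟨p, hp⟩ := h0 i j
    exact hp.has_fpower_series_dslope_fslope.analyticAt
  · have : dslope (fun w => g w i j) 0 =ᶠ[𝓝 c] fun z => (z - 0)⁻¹ * (g z i j - g 0 i j) := by
      filter_upwards [isOpen_ne.mem_nhds hc0] with z hz
      rw [dslope_of_ne _ hz, slope_def_field, div_eq_inv_mul]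
    rw [analyticAt_congr this]
    exact ((analyticAt_id.sub analyticAt_const).inv (by simpa using hc0)).mul
      ((hc i j).sub analyticAt_const)

theorem AnalyticAt.matrix_inv {g : ℂ → Matrix (Fin d) (Fin d) ℂ} {c : ℂ} (hg : AnalyticAt ℂ g c)
    (hu : IsUnit (g c)) : AnalyticAt ℂ (fun z => (g z)⁻¹) c := by
  simp only [Matrix.nonsing_inv_eq_ringInverse]
  obtain ⟨u, hu⟩ := hu
  have h := analyticAt_inverse (𝕜 := ℂ) u
  rw [hu] at h
  exact h.comp hg

theorem smul_diffQuot (g : ℂ → Matrix (Fin d) (Fin d) ℂ) (z : ℂ) :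
    z • diffQuot g z = g z - g 0 := by
  ext i j
  have := sub_smul_dslope (fun w => g w i j) 0 z
  simpa [diffQuot] using this

/-- The Taylor series at `0` of a matrix function, as a formal power series. -/
noncomputable def taylorSeries (g : ℂ → Matrix (Fin d) (Fin d) ℂ) :
    PowerSeries (Matrix (Fin d) (Fin d) ℂ) :=
  PowerSeries.mk (taylorCoeff g)

@[simp]
theorem coeff_taylorSeries (g : ℂ → Matrix (Fin d) (Fin d) ℂ) (n : ℕ) :
    PowerSeries.coeff n (taylorSeries g) = taylorCoeff g n :=
  PowerSeries.coeff_mk _ _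

theorem taylorCoeff_zero (g : ℂ → Matrix (Fin d) (Fin d) ℂ) : taylorCoeff g 0 = g 0 := by
  ext i j
  simp [taylorCoeff]

theorem taylorSeries_congr {g h : ℂ → Matrix (Fin d) (Fin d) ℂ} (e : g =ᶠ[𝓝 0] h) :
    taylorSeries g = taylorSeries h := by
  ext n i j
  simp only [coeff_taylorSeries, taylorCoeff, of_apply]
  rw [Filter.EventuallyEq.iteratedDeriv_eq]
  filter_upwards [e] with z hz
  rw [hz]

theorem taylorSeries_const (A : Matrix (Fin d) (Fin d) ℂ) :
    taylorSeries (fun _ => A) = PowerSeries.C A := by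
  ext n i j
  simp only [coeff_taylorSeries, taylorCoeff, of_apply, PowerSeries.coeff_C, iteratedDeriv_const]
  rcases eq_or_ne n 0 with rfl | hn <;> simp [*]

theorem taylorSeries_add {g h : ℂ → Matrix (Fin d) (Fin d) ℂ} (hg : AnalyticAt ℂ g 0)
    (hh : AnalyticAt ℂ h 0) :
    taylorSeries (fun z => g z + h z) = taylorSeries g + taylorSeries h := by
  ext n i j
  rw [analyticAt_matrix_iff] at *
  simp only [map_add, coeff_taylorSeries, taylorCoeff, of_apply, Matrix.add_apply]
  rw [iteratedDeriv_fun_add (hg i j).contDiffAt (hh i j).contDiffAt, add_div]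

theorem taylorSeries_sub {g h : ℂ → Matrix (Fin d) (Fin d) ℂ} (hg : AnalyticAt ℂ g 0)
    (hh : AnalyticAt ℂ h 0) :
    taylorSeries (fun z => g z - h z) = taylorSeries g - taylorSeries h := by
  have hs : AnalyticAt ℂ (fun z => g z - h z) 0 := hg.sub hh
  rw [eq_sub_iff_add_eq, ← taylorSeries_add hs hh]
  simp

/-- Leibniz' rule for matrix functions, in terms of Taylor series. -/
theorem taylorSeries_mul {g h : ℂ → Matrix (Fin d) (Fin d) ℂ} (hg : AnalyticAt ℂ g 0)
    (hh : AnalyticAt ℂ h 0) :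
    taylorSeries (fun z => g z * h z) = taylorSeries g * taylorSeries h := by
  ext n i j
  rw [analyticAt_matrix_iff] at *
  simp only [PowerSeries.coeff_mul, coeff_taylorSeries, taylorCoeff, of_apply, mul_apply,
    Matrix.sum_apply]
  have hgh (k : Fin d) : ContDiffAt ℂ n (fun z => g z i k * h z k j) 0 :=
    ((hg i k).mul (hh k j)).contDiffAt
  rw [iteratedDeriv_fun_sum fun k _ => hgh k, Finset.sum_div,
    Finset.sum_comm]
  refine Finset.sum_congr rfl fun k _ => ?_
  rw [iteratedDeriv_fun_mul (hg i k).contDiffAt (hh k j).contDiffAt, Finset.sum_div,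
    Finset.Nat.sum_antidiagonal_eq_sum_range_succ_mk]
  refine Finset.sum_congr rfl fun a ha => ?_
  have ha : a ≤ n := Nat.lt_succ_iff.1 (Finset.mem_range.1 ha)
  rw [Nat.cast_choose ℂ ha]
  have h1 : (n.factorial : ℂ) ≠ 0 := Nat.cast_ne_zero.2 n.factorial_ne_zero
  have h2 : (a.factorial : ℂ) ≠ 0 := Nat.cast_ne_zero.2 a.factorial_ne_zero
  have h3 : ((n - a).factorial : ℂ) ≠ 0 := Nat.cast_ne_zero.2 (n - a).factorial_ne_zero
  field_simp

/-- A matrix function which is the sum of a power series on the unit disc is analytic there, and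
the power series is its Taylor series. -/
theorem analyticAt_and_taylorSeries_of_hasSum {g : ℂ → Matrix (Fin d) (Fin d) ℂ}
    {c : ℕ → Matrix (Fin d) (Fin d) ℂ}
    (h : ∀ z : ℂ, ‖z‖ < 1 → ∀ i j, HasSum (fun n => z ^ n * c n i j) (g z i j)) :
    (∀ z : ℂ, ‖z‖ < 1 → AnalyticAt ℂ g z) ∧ taylorSeries g = PowerSeries.mk c := by
  have key (i j : Fin d) : HasFPowerSeriesOnBall (fun z => g z i j)
      (FormalMultilinearSeries.ofScalars ℂ fun n => c n i j) 0 1 := by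
    refine ⟨ENNReal.le_of_forall_nnreal_lt fun r hr => ?_, one_pos, fun {y} hy => ?_⟩
    · have hr1 : ‖((r : ℝ) : ℂ)‖ < 1 := by
        rw [Complex.norm_real, NNReal.norm_eq]
        exact_mod_cast hr
      refine FormalMultilinearSeries.le_radius_of_tendsto (l := 0) _ ?_
      have := (h _ hr1 i j).summable.tendsto_atTop_zero.norm
      simpa [FormalMultilinearSeries.ofScalars_norm, mul_comm] using this
    · rw [zero_add]
      have hy : ‖y‖ < 1 := by
        rw [Metric.mem_eball, edist_zero_right, ← ofReal_norm, ENNReal.ofReal_lt_one] at hy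
        exact hy
      simpa [FormalMultilinearSeries.ofScalars_apply_eq, mul_comm] using h y hy i j
  refine ⟨fun z hz => analyticAt_matrix_iff.2 fun i j => ?_, ?_⟩
  · refine (key i j).analyticAt_of_mem ?_
    rw [Metric.mem_eball, edist_zero_right, ← ofReal_norm, ENNReal.ofReal_lt_one]
    exact hz
  ext n i j
  have e := (key i j).hasFPowerSeriesAt.eq_formalMultilinearSeries
    (key i j).hasFPowerSeriesAt.analyticAt.hasFPowerSeriesAt
  have := congrArg (fun p => FormalMultilinearSeries.coeff p n) e
  simp only [FormalMultilinearSeries.coeff_ofScalars] at this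
  rw [coeff_taylorSeries, PowerSeries.coeff_mk, taylorCoeff, of_apply, this]

theorem taylorSeries_smul {g : ℂ → Matrix (Fin d) (Fin d) ℂ} (hg : AnalyticAt ℂ g 0) :
    taylorSeries (fun z => z • g z) = PowerSeries.X * taylorSeries g := by
  have h1 : AnalyticAt ℂ (fun z : ℂ => z • (1 : Matrix (Fin d) (Fin d) ℂ)) 0 :=
    analyticAt_id.smul analyticAt_const
  have h2 : taylorSeries (fun z : ℂ => z • (1 : Matrix (Fin d) (Fin d) ℂ)) = PowerSeries.X := by
    ext n i j
    simp only [coeff_taylorSeries, taylorCoeff, of_apply, Matrix.smul_apply, smul_eq_mul,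
      iteratedDeriv_mul_const_field, PowerSeries.coeff_X, iteratedDeriv_fun_id_zero]
    split_ifs with h <;> simp [h]
  rw [← h2, ← taylorSeries_mul h1 hg]
  simp

end Taylor

/-! ### Defect matrices -/

section Defect

variable {d : ℕ}

open scoped MatrixOrder in
theorem posDef_cfcSqrt {A : Matrix (Fin d) (Fin d) ℂ} (hA : A.PosDef) :
    (CFC.sqrt A).PosDef ∧ CFC.sqrt A * CFC.sqrt A = A := by
  have h : CFC.sqrt A * CFC.sqrt A = A := CFC.sqrt_mul_sqrt_self A hA.posSemidef.nonneg
  refine ⟨(CFC.sqrt_nonneg A).posSemidef.posDef_iff_isUnit.2 ?_, h⟩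
  have hu := hA.isUnit
  rw [← h] at hu
  exact ((Commute.refl _).isUnit_mul_iff.1 hu).1

theorem posDef_one_sub_mul_conjTranspose {α : Matrix (Fin d) (Fin d) ℂ}
    (hα : (1 - αᴴ * α).PosDef) : (1 - α * αᴴ).PosDef := by
  have hherm : (1 - α * αᴴ).IsHermitian := by
    simp [IsHermitian, conjTranspose_sub, conjTranspose_mul]
  -- this decomposition gives semidefiniteness; the determinant identity below gives the rest
  have hdec : 1 - α * αᴴ = (1 - α * αᴴ)ᴴ * (1 - α * αᴴ) + α * (1 - αᴴ * α) * αᴴ := by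
    rw [hherm.eq]
    noncomm_ring
  have hps : (1 - α * αᴴ).PosSemidef := by
    rw [hdec]
    exact (posSemidef_conjTranspose_mul_self _).add
      (hα.posSemidef.mul_mul_conjTranspose_same α)
  rw [hps.posDef_iff_isUnit, isUnit_iff_isUnit_det, det_one_sub_mul_comm,
    ← isUnit_iff_isUnit_det]
  exact hα.isUnit

/-- A Sylvester equation `B D + D A = 0` with positive definite coefficients only has the trivial
solution. -/
theorem eq_zero_of_mul_add_mul_eq_zero {A B D : Matrix (Fin d) (Fin d) ℂ} (hA : A.PosDef)
    (hB : B.PosDef) (h : B * D + D * A = 0) : D = 0 := by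
  have h1 := (hB.posSemidef.conjTranspose_mul_mul_same D).trace_nonneg
  have h2 := (hA.posSemidef.mul_mul_conjTranspose_same D).trace_nonneg
  have h3 : (Dᴴ * B * D).trace + (D * A * Dᴴ).trace = 0 := by
    rw [Matrix.trace_mul_comm (D * A), ← trace_add, Matrix.mul_assoc, ← mul_add, h]
    simp
  have h4 : (Dᴴ * B * D).trace = 0 := by
    refine le_antisymm ?_ h1
    rw [eq_neg_of_add_eq_zero_left h3]
    exact neg_nonpos.2 h2
  have h5 := (hB.posSemidef.conjTranspose_mul_mul_same D).trace_eq_zero_iff.1 h4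
  -- every column of `D` is isotropic for the positive definite form `B`
  ext i j
  by_contra hij
  have hcol : (fun k => D k j) ≠ 0 := fun h0 => hij (congrFun h0 i)
  have hpos := hB.dotProduct_mulVec_pos hcol
  have : star (fun k => D k j) ⬝ᵥ B *ᵥ (fun k => D k j) = (Dᴴ * B * D) j j := by
    rw [Matrix.mul_assoc, mul_apply]
    rfl
  rw [this, h5] at hpos
  exact lt_irrefl _ hpos

variable {α : Matrix (Fin d) (Fin d) ℂ} (hα : (1 - αᴴ * α).PosDef)
include hα

theorem posDef_defectL : (defectL α).PosDef := (posDef_cfcSqrt hα).1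

theorem defectL_mul_self : defectL α * defectL α = 1 - αᴴ * α := (posDef_cfcSqrt hα).2

theorem posDef_defectR : (defectR α).PosDef :=
  (posDef_cfcSqrt (posDef_one_sub_mul_conjTranspose hα)).1

theorem defectR_mul_self : defectR α * defectR α = 1 - α * αᴴ :=
  (posDef_cfcSqrt (posDef_one_sub_mul_conjTranspose hα)).2

theorem inv_defectL_mul : (defectL α)⁻¹ * defectL α = 1 :=
  nonsing_inv_mul _ ((isUnit_iff_isUnit_det _).1 (posDef_defectL hα).isUnit)

theorem defectL_mul_inv : defectL α * (defectL α)⁻¹ = 1 :=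
  mul_nonsing_inv _ ((isUnit_iff_isUnit_det _).1 (posDef_defectL hα).isUnit)

theorem inv_defectR_mul : (defectR α)⁻¹ * defectR α = 1 :=
  nonsing_inv_mul _ ((isUnit_iff_isUnit_det _).1 (posDef_defectR hα).isUnit)

theorem defectR_mul_inv : defectR α * (defectR α)⁻¹ = 1 :=
  mul_nonsing_inv _ ((isUnit_iff_isUnit_det _).1 (posDef_defectR hα).isUnit)

theorem inv_defectL_mul_inv_defectL :
    (defectL α)⁻¹ * (defectL α)⁻¹ * (1 - αᴴ * α) = 1 := by
  rw [← defectL_mul_self hα, Matrix.mul_assoc, ← Matrix.mul_assoc _ (defectL α),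
    inv_defectL_mul hα, Matrix.one_mul, inv_defectL_mul hα]

theorem inv_defectR_mul_inv_defectR :
    (defectR α)⁻¹ * (defectR α)⁻¹ * (1 - α * αᴴ) = 1 := by
  rw [← defectR_mul_self hα, Matrix.mul_assoc, ← Matrix.mul_assoc _ (defectR α),
    inv_defectR_mul hα, Matrix.one_mul, inv_defectR_mul hα]

/-- The square roots inherit the intertwining relation `α (1 - α^* α) = (1 - α α^*) α`. -/
theorem mul_defectL : α * defectL α = defectR α * α := by
  refine sub_eq_zero.1 (eq_zero_of_mul_add_mul_eq_zero (posDef_defectL hα) (posDef_defectR hα) ?_)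
  have : defectR α * (α * defectL α - defectR α * α) + (α * defectL α - defectR α * α) * defectL α
      = α * (defectL α * defectL α) - (defectR α * defectR α) * α := by noncomm_ring
  rw [this, defectL_mul_self hα, defectR_mul_self hα]
  noncomm_ring

theorem inv_defectR_mul_eq : (defectR α)⁻¹ * α = α * (defectL α)⁻¹ := by
  calc (defectR α)⁻¹ * α = (defectR α)⁻¹ * (α * defectL α) * (defectL α)⁻¹ := by
        rw [Matrix.mul_assoc, Matrix.mul_assoc, defectL_mul_inv hα, Matrix.mul_one]
    _ = α * (defectL α)⁻¹ := by
        rw [mul_defectL hα, ← Matrix.mul_assoc, inv_defectR_mul hα, Matrix.one_mul]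

theorem inv_defectL_mul_conjTranspose : (defectL α)⁻¹ * αᴴ = αᴴ * (defectR α)⁻¹ := by
  have := congrArg conjTranspose (inv_defectR_mul_eq hα)
  rw [conjTranspose_mul, conjTranspose_mul, conjTranspose_nonsing_inv, conjTranspose_nonsing_inv,
    (posDef_defectL hα).isHermitian.eq, (posDef_defectR hα).isHermitian.eq] at this
  exact this.symm

/-- The map `(a, b) ↦ (ρ_L⁻¹ (a + α^* b), ρ_R⁻¹ (b + α a))` preserves the indefinite form
`a^* a - b^* b`. -/
theorem conjTranspose_mul_sub_of_defect (a b : Matrix (Fin d) (Fin d) ℂ) :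
    ((defectL α)⁻¹ * (a + αᴴ * b))ᴴ * ((defectL α)⁻¹ * (a + αᴴ * b)) -
      ((defectR α)⁻¹ * (b + α * a))ᴴ * ((defectR α)⁻¹ * (b + α * a)) = aᴴ * a - bᴴ * b := by
  set L := (defectL α)⁻¹
  set R := (defectR α)⁻¹
  have hLh : Lᴴ = L := (posDef_defectL hα).isHermitian.inv
  have hRh : Rᴴ = R := (posDef_defectR hα).isHermitian.inv
  have e1 : R * α = α * L := inv_defectR_mul_eq hα
  have e2 : L * αᴴ = αᴴ * R := inv_defectL_mul_conjTranspose hα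
  have e3 : L * L * (1 - αᴴ * α) = 1 := inv_defectL_mul_inv_defectL hα
  have e4 : R * R * (1 - α * αᴴ) = 1 := inv_defectR_mul_inv_defectR hα
  have f1 : αᴴ * R * R = L * L * αᴴ := by rw [← e2, Matrix.mul_assoc, ← e2, Matrix.mul_assoc]
  have f2 : α * L * L = R * R * α := by rw [← e1, Matrix.mul_assoc, ← e1, Matrix.mul_assoc]
  simp only [conjTranspose_mul, conjTranspose_add, conjTranspose_conjTranspose, hLh, hRh]
  calc _ = aᴴ * (L * L - αᴴ * R * R * α) * a + aᴴ * (L * L * αᴴ - αᴴ * R * R) * b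
        + bᴴ * (α * L * L - R * R * α) * a - bᴴ * (R * R - α * L * L * αᴴ) * b := by noncomm_ring
    _ = aᴴ * (L * L * (1 - αᴴ * α)) * a - bᴴ * (R * R * (1 - α * αᴴ)) * b := by
        rw [f1, f2]; noncomm_ring
    _ = _ := by rw [e3, e4, Matrix.mul_one, Matrix.mul_one]

end Defect

/-! ### One step of the Schur algorithm -/

section Step

open scoped Matrix.Norms.L2Operator

variable {d : ℕ} {g : ℂ → Matrix (Fin d) (Fin d) ℂ}

theorem AnalyticAt.schurStep (hg : AnalyticAt ℂ g 0) (hα : (1 - (g 0)ᴴ * g 0).PosDef) :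
    AnalyticAt ℂ (schurStep g) 0 := by
  have h1 : AnalyticAt ℂ (fun z => 1 - (g 0)ᴴ * g z) 0 :=
    analyticAt_const.sub (analyticAt_const.mul hg)
  exact ((analyticAt_const.mul (AnalyticAt.diffQuot hg hg)).mul
    (AnalyticAt.matrix_inv h1 hα.isUnit)).mul analyticAt_const

/-- The linear fractional relation between a function and its Schur transform, freed of the
inverse of `1 - α^* g`. -/
theorem sub_eq_of_schurStep (hα : (1 - (g 0)ᴴ * g 0).PosDef) {z : ℂ}
    (hz : IsUnit (1 - (g 0)ᴴ * g z)) :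
    g z - g 0 = (1 - g z * (g 0)ᴴ) * (defectR (g 0))⁻¹ * (z • schurStep g z) * defectL (g 0) := by
  have hd := smul_diffQuot g z
  generalize hαdef : g 0 = α at *
  have e0 : z • schurStep g z = (defectR α)⁻¹ * (g z - α) * (1 - αᴴ * g z)⁻¹ * defectL α := by
    rw [schurStep, hαdef, ← hd]
    simp
  set L := (defectL α)⁻¹
  set R := (defectR α)⁻¹
  have e1 : R * α = α * L := inv_defectR_mul_eq hα
  have e2 : L * αᴴ = αᴴ * R := inv_defectL_mul_conjTranspose hα
  have e3 : L * L * (1 - αᴴ * α) = 1 := inv_defectL_mul_inv_defectL hα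
  have e4 : (1 - α * αᴴ) * (R * R) = 1 :=
    mul_eq_one_comm.1 (inv_defectR_mul_inv_defectR hα)
  have f1 : αᴴ * (R * R) = L * L * αᴴ := by
    rw [← Matrix.mul_assoc, ← e2, Matrix.mul_assoc, ← e2, Matrix.mul_assoc]
  -- both sides equal `D - D α^* R² D` for `D = g z - α`
  have key : (1 - g z * αᴴ) * (R * R) * (g z - α) = (g z - α) * (L * L) * (1 - αᴴ * g z) := by
    calc (1 - g z * αᴴ) * (R * R) * (g z - α)
        = (1 - α * αᴴ) * (R * R) * (g z - α) - (g z - α) * (αᴴ * (R * R)) * (g z - α) := by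
          noncomm_ring
      _ = (g z - α) * (L * L * (1 - αᴴ * α)) - (g z - α) * (L * L * αᴴ) * (g z - α) := by
          rw [e4, f1, e3, Matrix.one_mul, Matrix.mul_one]
      _ = _ := by noncomm_ring
  have hinv : (1 - αᴴ * g z) * (1 - αᴴ * g z)⁻¹ = 1 :=
    mul_nonsing_inv _ ((isUnit_iff_isUnit_det _).1 hz)
  rw [e0]
  symm
  calc (1 - g z * αᴴ) * R * (R * (g z - α) * (1 - αᴴ * g z)⁻¹ * defectL α) * defectL α
      = ((1 - g z * αᴴ) * (R * R) * (g z - α)) * (1 - αᴴ * g z)⁻¹ * (defectL α * defectL α) := by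
        noncomm_ring
    _ = (g z - α) * (L * L) * ((1 - αᴴ * g z) * (1 - αᴴ * g z)⁻¹) * (defectL α * defectL α) := by
        rw [key]; noncomm_ring
    _ = (g z - α) * (L * L * (1 - αᴴ * α)) := by
        rw [hinv, defectL_mul_self hα]; noncomm_ring
    _ = g z - α := by rw [e3, Matrix.mul_one]

open PowerSeries in
/-- The relation between a function and its Schur transform, for Taylor series. -/
theorem taylorSeries_schurStep (hg : AnalyticAt ℂ g 0) (hα : (1 - (g 0)ᴴ * g 0).PosDef) :
    taylorSeries g - C (g 0) = (1 - taylorSeries g * C (g 0)ᴴ) * C (defectR (g 0))⁻¹ *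
      (X * taylorSeries (schurStep g)) * C (defectL (g 0)) := by
  have hs := AnalyticAt.schurStep hg hα
  have hzs : AnalyticAt ℂ (fun z => z • schurStep g z) 0 := analyticAt_id.smul hs
  have h1 : AnalyticAt ℂ (fun z => g z * (g 0)ᴴ) 0 := hg.mul analyticAt_const
  have h2 : AnalyticAt ℂ (fun z => 1 - g z * (g 0)ᴴ) 0 := analyticAt_const.sub h1
  have h3 : AnalyticAt ℂ (fun z => (1 - g z * (g 0)ᴴ) * (defectR (g 0))⁻¹) 0 :=
    h2.mul analyticAt_const
  have h4 : AnalyticAt ℂ (fun z => (1 - g z * (g 0)ᴴ) * (defectR (g 0))⁻¹ *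
    (z • schurStep g z)) 0 := h3.mul hzs
  rw [← taylorSeries_const, ← taylorSeries_sub hg analyticAt_const, ← taylorSeries_const,
    ← taylorSeries_const, ← taylorSeries_const, ← map_one C, ← taylorSeries_const,
    ← taylorSeries_smul hs, ← taylorSeries_mul hg analyticAt_const,
    ← taylorSeries_sub analyticAt_const h1, ← taylorSeries_mul h2 analyticAt_const,
    ← taylorSeries_mul h3 hzs, ← taylorSeries_mul h4 analyticAt_const]
  refine taylorSeries_congr ?_
  have hc : ContinuousAt (fun z => 1 - (g 0)ᴴ * g z) 0 :=
    (analyticAt_const.sub (analyticAt_const.mul hg)).continuousAt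
  filter_upwards [hc.eventually (Units.isOpen.mem_nhds hα.isUnit)] with z hz
  exact sub_eq_of_schurStep hα hz

end Step

/-! ### The Schur function of a matrix measure -/

section SchurFunction

open scoped Matrix.Norms.L2Operator

variable {d : ℕ}

open scoped MatrixOrder in
theorem norm_le_one_iff_posSemidef {A : Matrix (Fin d) (Fin d) ℂ} :
    ‖A‖ ≤ 1 ↔ (1 - Aᴴ * A).PosSemidef := by
  have h0 : 0 ≤ star A * A := star_mul_self_nonneg A
  have h1 : ‖A‖ ≤ 1 ↔ ‖star A * A‖ ≤ 1 := by
    rw [CStarRing.norm_star_mul_self, ← sq, sq_le_one_iff₀ (norm_nonneg A)]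
  rw [h1, CStarAlgebra.norm_le_one_iff_of_nonneg _ h0]
  exact Matrix.le_iff

theorem isUnit_of_posDef_add_conjTranspose {B : Matrix (Fin d) (Fin d) ℂ}
    (hB : (B + Bᴴ).PosDef) : IsUnit B := by
  rw [isUnit_iff_isUnit_det, isUnit_iff_ne_zero]
  intro h
  obtain ⟨v, hv, hv0⟩ := exists_mulVec_eq_zero_iff.2 h
  have := hB.dotProduct_mulVec_pos hv
  rw [add_mulVec, hv0, zero_add, dotProduct_mulVec, ← star_mulVec, hv0] at this
  simp at this

theorem isUnit_herglotz_add_one {M : MatrixMeasure d} (hM : M.IsPositive)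
    (hnt : M.IsNontrivial) {z : ℂ} (hz : ‖z‖ < 1) : IsUnit (M.herglotz z + 1) := by
  refine isUnit_of_posDef_add_conjTranspose ?_
  have : M.herglotz z + 1 + (M.herglotz z + 1)ᴴ =
      (M.herglotz z + (M.herglotz z)ᴴ) + (1 + 1) := by
    rw [conjTranspose_add, conjTranspose_one]; abel
  rw [this]
  exact PosDef.posSemidef_add (MatrixMeasure.posSemidef_herglotz_add_conjTranspose hM hnt hz)
    (PosDef.one.add PosDef.one)

theorem herglotz_add_one_mul_inv {M : MatrixMeasure d} (hM : M.IsPositive)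
    (hnt : M.IsNontrivial) {z : ℂ} (hz : ‖z‖ < 1) :
    (M.herglotz z + 1) * (M.herglotz z + 1)⁻¹ = 1 :=
  mul_nonsing_inv _ ((isUnit_iff_isUnit_det _).1 (isUnit_herglotz_add_one hM hnt hz))

variable {M : MatrixMeasure d} (h1 : M Set.univ = 1)
include h1

theorem analyticAt_herglotz {z : ℂ} (hz : ‖z‖ < 1) : AnalyticAt ℂ M.herglotz z :=
  (analyticAt_and_taylorSeries_of_hasSum fun _ hz i j => M.hasSum_herglotz h1 hz i j).1 z hz

theorem taylorSeries_herglotz : taylorSeries M.herglotz = PowerSeries.mk M.herglotzCoeff :=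
  (analyticAt_and_taylorSeries_of_hasSum fun _ hz i j => M.hasSum_herglotz h1 hz i j).2

theorem herglotz_zero : M.herglotz 0 = 1 := by
  rw [← taylorCoeff_zero M.herglotz, ← coeff_taylorSeries, taylorSeries_herglotz h1, PowerSeries.coeff_mk,
    MatrixMeasure.herglotzCoeff, if_pos rfl]

theorem smul_schurFunction (z : ℂ) :
    z • schurFunction M z = (M.herglotz z - 1) * (M.herglotz z + 1)⁻¹ := by
  rw [schurFunction, ← smul_mul_assoc, smul_diffQuot, herglotz_zero h1]

variable (hM : M.IsPositive) (hnt : M.IsNontrivial)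
include hM hnt

theorem analyticAt_schurFunction {z : ℂ} (hz : ‖z‖ < 1) : AnalyticAt ℂ (schurFunction M) z := by
  have h := analyticAt_herglotz h1 hz
  have h0 : AnalyticAt ℂ M.herglotz 0 := analyticAt_herglotz h1 (by simp)
  have h2 : AnalyticAt ℂ (fun z => M.herglotz z + 1) z := h.add analyticAt_const
  exact (AnalyticAt.diffQuot h0 h).mul
    (AnalyticAt.matrix_inv h2 (isUnit_herglotz_add_one hM hnt hz))

theorem one_sub_smul_schurFunction {z : ℂ} (hz : ‖z‖ < 1) :
    1 - z • schurFunction M z = (2 : ℂ) • (M.herglotz z + 1)⁻¹ := by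
  rw [smul_schurFunction h1]
  nth_rewrite 1 [← herglotz_add_one_mul_inv hM hnt hz]
  rw [← sub_mul, add_sub_sub_cancel, add_mul, Matrix.one_mul, two_smul]

theorem one_add_smul_schurFunction {z : ℂ} (hz : ‖z‖ < 1) :
    1 + z • schurFunction M z = M.herglotz z * (1 - z • schurFunction M z) := by
  rw [one_sub_smul_schurFunction h1 hM hnt hz, smul_schurFunction h1]
  nth_rewrite 1 [← herglotz_add_one_mul_inv hM hnt hz]
  rw [← add_mul, add_add_sub_cancel, add_mul, two_smul, mul_add]

theorem isUnit_one_sub_smul_schurFunction {z : ℂ} (hz : ‖z‖ < 1) :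
    IsUnit (1 - z • schurFunction M z) := by
  rw [one_sub_smul_schurFunction h1 hM hnt hz]
  have h := (isUnit_nonsing_inv_iff).2 (isUnit_herglotz_add_one hM hnt hz)
  exact h.smul (Units.mk0 (2 : ℂ) two_ne_zero)

theorem herglotz_eq {z : ℂ} (hz : ‖z‖ < 1) :
    M.herglotz z = (1 + z • schurFunction M z) * (1 - z • schurFunction M z)⁻¹ := by
  rw [one_add_smul_schurFunction h1 hM hnt hz, Matrix.mul_assoc, mul_nonsing_inv _
    ((isUnit_iff_isUnit_det _).1 (isUnit_one_sub_smul_schurFunction h1 hM hnt hz)), Matrix.mul_one]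

/-- The Cayley transform of the Herglotz function is contractive, since `F + F^* ≥ 0`. -/
theorem norm_smul_schurFunction_le {z : ℂ} (hz : ‖z‖ < 1) : ‖z • schurFunction M z‖ ≤ 1 := by
  rw [norm_le_one_iff_posSemidef, smul_schurFunction h1]
  have hW := herglotz_add_one_mul_inv hM hnt hz
  set F := M.herglotz z
  set W := (F + 1)⁻¹
  have e : 1 - ((F - 1) * W)ᴴ * ((F - 1) * W) =
      Wᴴ * ((F + Fᴴ) + (F + Fᴴ)) * W := by
    have : (1 : Matrix (Fin d) (Fin d) ℂ) = ((F + 1) * W)ᴴ * ((F + 1) * W) := by simp [hW]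
    nth_rewrite 1 [this]
    simp only [conjTranspose_mul, conjTranspose_add, conjTranspose_sub, conjTranspose_one]
    noncomm_ring
  have hF := M.posSemidef_herglotz_add_conjTranspose hM hnt hz
  rw [e]
  exact (hF.add hF).conjTranspose_mul_mul_same W

/-- Schwarz' lemma for `z f(z)`. -/
theorem norm_schurFunction_le {z : ℂ} (hz : ‖z‖ < 1) : ‖schurFunction M z‖ ≤ 1 := by
  have han (c : ℂ) (hc : ‖c‖ < 1) := analyticAt_schurFunction h1 hM hnt hc
  have hd : DifferentiableOn ℂ (fun z => z • schurFunction M z) (Metric.ball 0 1) := by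
    intro c hc
    exact (differentiableAt_id.smul
      (han c (by simpa using hc)).differentiableAt).differentiableWithinAt
  have hmaps : Set.MapsTo (fun z => z • schurFunction M z) (Metric.ball 0 1)
      (Metric.closedBall ((0 : ℂ) • schurFunction M 0) 1) := by
    intro c hc
    rw [zero_smul, mem_closedBall_zero_iff]
    exact norm_smul_schurFunction_le h1 hM hnt (by simpa using hc)
  have key := Complex.norm_dslope_le_div_of_mapsTo_ball hd hmaps (z := z) (by simpa using hz)
  have : dslope (fun z => z • schurFunction M z) 0 z = schurFunction M z := by
    rcases eq_or_ne z 0 with rfl | h0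
    · rw [dslope_same]
      have := (hasDerivAt_id (0 : ℂ)).smul (han 0 (by simp)).differentiableAt.hasDerivAt
      have e : HasDerivAt (fun z => z • schurFunction M z) _ 0 := this
      simpa using e.deriv
    · rw [dslope_of_ne _ h0, slope_def_module]
      simp [smul_smul, h0]
  rw [this] at key
  simpa using key

theorem hasSum_schurFunction {z : ℂ} (hz : ‖z‖ < 1) :
    HasSum (fun k : ℕ => z ^ k • taylorCoeff (schurFunction M) k) (schurFunction M z) := by
  refine Pi.hasSum.2 fun i => Pi.hasSum.2 fun j => ?_
  have hd : DifferentiableOn ℂ (fun z => schurFunction M z i j) (Metric.ball 0 1) := fun c hc =>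
    (analyticAt_matrix_iff.1 (analyticAt_schurFunction h1 hM hnt (by simpa using hc))
      i j).differentiableAt.differentiableWithinAt
  have := Complex.hasSum_taylorSeries_on_ball hd (z := z) (by simpa using hz)
  refine this.congr_fun fun k => ?_
  change z ^ k * (_ / _) = _
  simp only [sub_zero, smul_eq_mul]
  ring

open PowerSeries in
/-- The relation `F (1 - z f) = 1 + z f` for Taylor series. -/
theorem taylorSeries_herglotz_mul :
    taylorSeries M.herglotz * (1 - X * taylorSeries (schurFunction M)) =
      1 + X * taylorSeries (schurFunction M) := by
  have hF : AnalyticAt ℂ M.herglotz 0 := analyticAt_herglotz h1 (by simp)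
  have hf : AnalyticAt ℂ (schurFunction M) 0 := analyticAt_schurFunction h1 hM hnt (by simp)
  have hzf : AnalyticAt ℂ (fun z => z • schurFunction M z) 0 := analyticAt_id.smul hf
  have h2 : AnalyticAt ℂ (fun z => 1 - z • schurFunction M z) 0 := analyticAt_const.sub hzf
  rw [← map_one C, ← taylorSeries_const, ← taylorSeries_smul hf,
    ← taylorSeries_sub analyticAt_const hzf, ← taylorSeries_add analyticAt_const hzf,
    ← taylorSeries_mul hF h2]
  refine taylorSeries_congr ?_
  filter_upwards [Metric.ball_mem_nhds (0 : ℂ) one_pos] with z hz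
  exact (one_add_smul_schurFunction h1 hM hnt (by simpa using hz)).symm

end SchurFunction

/-! ### Non-triviality and the Schur algorithm -/

section Graph

open PowerSeries

variable {d : ℕ} {φ ψ p q : PowerSeries (Matrix (Fin d) (Fin d) ℂ)} {N : ℕ}

theorem coeff_mul_eq_zero_of_lt {R : Type*} [Semiring R] {E : PowerSeries R}
    (hE : ∀ i < N, coeff i E = 0) (K : PowerSeries R) {i : ℕ} (hi : i < N) :
    coeff i (K * E) = 0 := by
  rw [coeff_mul]
  refine Finset.sum_eq_zero fun a ha => ?_
  have := Finset.HasAntidiagonal.mem_antidiagonal.1 ha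
  rw [hE _ (by omega), mul_zero]

theorem coeff_X_mul_eq_zero_of_lt {R : Type*} [Semiring R] {E : PowerSeries R}
    (hE : ∀ i < N, coeff i E = 0) {i : ℕ} (hi : i < N + 1) : coeff i (X * E) = 0 := by
  cases i with
  | zero => exact coeff_zero_X_mul E
  | succ i => rw [coeff_succ_X_mul, hE i (by omega)]

/-- Matrix polynomials `p ≠ 0` and `q` of degree less than `N` with `φ p = q` up to order `N`. -/
structure IsGraphPair (φ : PowerSeries (Matrix (Fin d) (Fin d) ℂ)) (N : ℕ)
    (p q : PowerSeries (Matrix (Fin d) (Fin d) ℂ)) : Prop where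
  left_eq_zero : ∀ i, N ≤ i → coeff i p = 0
  right_eq_zero : ∀ i, N ≤ i → coeff i q = 0
  left_ne_zero : p ≠ 0
  graph : ∀ i < N, coeff i (φ * p) = coeff i q

/-- The indefinite form `∑ (p_i^* p_i - q_i^* q_i)` of two matrix polynomials of degree less than
`N`. -/
noncomputable def gramDiff (N : ℕ) (p q : PowerSeries (Matrix (Fin d) (Fin d) ℂ)) :
    Matrix (Fin d) (Fin d) ℂ :=
  ∑ i ∈ Finset.range N, ((coeff i p)ᴴ * coeff i p - (coeff i q)ᴴ * coeff i q)

theorem gramDiff_X_mul (hp : coeff N p = 0) : gramDiff (N + 1) p (X * q) = gramDiff N p q := by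
  simp only [gramDiff, Finset.sum_sub_distrib]
  congr 1
  · rw [Finset.sum_range_succ, hp]
    simp
  · rw [Finset.sum_range_succ']
    simp [coeff_succ_X_mul]

/-- The lowest coefficient of `p` cannot come from `B z q`, because `q = φ p` up to order `N`. -/
theorem IsGraphPair.ne_C_mul_X_mul (h : IsGraphPair φ N p q) (B : Matrix (Fin d) (Fin d) ℂ) :
    p ≠ C B * (X * q) := by
  intro hp
  refine h.left_ne_zero (PowerSeries.ext fun i => ?_)
  induction i using Nat.strong_induction_on with
  | _ i ih =>
    rcases le_or_gt N i with hi | hi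
    · rw [h.left_eq_zero i hi, map_zero]
    · rw [hp, coeff_C_mul]
      cases i with
      | zero => simp
      | succ k =>
        rw [coeff_succ_X_mul, ← h.graph k (by omega), coeff_mul_eq_zero_of_lt
          (N := k + 1) (fun j hj => by simpa using ih j hj) φ (Nat.lt_succ_self k)]
        simp

/-- Going one step back in the Schur algorithm, a pair on the graph of the Schur transform yields
a pair on the graph of the function itself, with the same value of the indefinite form. -/
theorem IsGraphPair.descend {α : Matrix (Fin d) (Fin d) ℂ} (hα : (1 - αᴴ * α).PosDef)
    (hφ : φ - C α = (1 - φ * C αᴴ) * C (defectR α)⁻¹ * (X * ψ) * C (defectL α))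
    (h : IsGraphPair ψ N p q) :
    IsGraphPair φ (N + 1) (C (defectL α)⁻¹ * (p + C αᴴ * (X * q)))
      (C (defectR α)⁻¹ * (X * q + C α * p)) ∧
    gramDiff (N + 1) (C (defectL α)⁻¹ * (p + C αᴴ * (X * q)))
      (C (defectR α)⁻¹ * (X * q + C α * p)) = gramDiff N p q := by
  have e1 : C (defectR α)⁻¹ * C α = C α * C (defectL α)⁻¹ := by
    rw [← map_mul, ← map_mul, inv_defectR_mul_eq hα]
  have e2 : C (defectL α)⁻¹ * C αᴴ = C αᴴ * C (defectR α)⁻¹ := by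
    rw [← map_mul, ← map_mul, inv_defectL_mul_conjTranspose hα]
  have e3 : C (defectL α) * C (defectL α)⁻¹ = 1 := by
    rw [← map_mul, defectL_mul_inv hα, map_one]
  have hXq (i : ℕ) (hi : N + 1 ≤ i) : coeff i (X * q) = 0 := by
    obtain ⟨k, rfl⟩ : ∃ k, i = k + 1 := ⟨i - 1, by omega⟩
    rw [coeff_succ_X_mul, h.right_eq_zero k (by omega)]
  refine ⟨⟨fun i hi => ?_, fun i hi => ?_, fun h0 => ?_, fun i hi => ?_⟩, ?_⟩
  · simp [coeff_C_mul, hXq i hi, h.left_eq_zero i (by omega)]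
  · simp [coeff_C_mul, hXq i hi, h.left_eq_zero i (by omega)]
  · refine h.ne_C_mul_X_mul (-αᴴ) ?_
    have := congrArg (C (defectL α) * ·) h0
    simp only [← mul_assoc, e3, one_mul, mul_zero] at this
    rw [map_neg, neg_mul, ← mul_assoc]
    exact eq_neg_of_add_eq_zero_left this
  · have key : φ * (C (defectL α)⁻¹ * (p + C αᴴ * (X * q))) - C (defectR α)⁻¹ * (X * q + C α * p) =
        (1 - φ * C αᴴ) * C (defectR α)⁻¹ * (X * (ψ * p - q)) := by
      calc _ = (φ - C α) * C (defectL α)⁻¹ * p + φ * (C (defectL α)⁻¹ * C αᴴ) * (X * q)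
            - C (defectR α)⁻¹ * (X * q)
            - (C (defectR α)⁻¹ * C α - C α * C (defectL α)⁻¹) * p := by noncomm_ring
        _ = (1 - φ * C αᴴ) * C (defectR α)⁻¹ * (X * ψ) * (C (defectL α) * C (defectL α)⁻¹) * p
            + φ * (C αᴴ * C (defectR α)⁻¹) * (X * q) - C (defectR α)⁻¹ * (X * q) := by
          rw [hφ, e1, e2]; noncomm_ring
        _ = _ := by rw [e3]; noncomm_ring
    have hz : ∀ j < N, coeff j (ψ * p - q) = 0 := fun j hj => by
      rw [map_sub, h.graph j hj, sub_self]
    rw [← sub_eq_zero, ← map_sub, key]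
    exact coeff_mul_eq_zero_of_lt (fun j hj => coeff_X_mul_eq_zero_of_lt hz hj) _ hi
  · rw [← gramDiff_X_mul (h.left_eq_zero N le_rfl)]
    refine Finset.sum_congr rfl fun i _ => ?_
    simp only [coeff_C_mul, map_add]
    exact conjTranspose_mul_sub_of_defect hα _ _

end Graph

section Nondegenerate

open PowerSeries

variable {d : ℕ} {M : MatrixMeasure d}

/-- The quadratic form of the moments at a polynomial `p` is the Hermitian part of the pairing of
the coefficients of `p` with those of `F p`. -/
theorem two_smul_sandwich (h1 : M Set.univ = 1) (hM : M.IsPositive) {N : ℕ}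
    (p : PowerSeries (Matrix (Fin d) (Fin d) ℂ)) :
    (2 : ℂ) • M.sandwich (fun w => (MatrixMeasure.polyValue (trunc (N + 1) p) w)ᴴ)
        (MatrixMeasure.polyValue (trunc (N + 1) p)) =
      (∑ i ∈ Finset.range (N + 1), (coeff i p)ᴴ * coeff i (mk M.herglotzCoeff * p)) +
      (∑ i ∈ Finset.range (N + 1), (coeff i p)ᴴ * coeff i (mk M.herglotzCoeff * p))ᴴ := by
  -- the block lower triangular Toeplitz matrix of `F`
  let G (i b : ℕ) : Matrix (Fin d) (Fin d) ℂ := if b ≤ i then M.herglotzCoeff (i - b) else 0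
  have hG (i b : ℕ) : G i b + (G b i)ᴴ = (2 : ℂ) • M.moment (b - i) := by
    have hs : star (2 : ℂ) = 2 := by simp
    rcases lt_trichotomy b i with h | rfl | h
    · simp only [G, if_pos h.le, if_neg h.not_ge, MatrixMeasure.herglotzCoeff,
        if_neg (Nat.sub_pos_of_lt h).ne', Nat.cast_sub h.le, conjTranspose_zero, add_zero, neg_sub]
    · simp [G, MatrixMeasure.herglotzCoeff, M.moment_zero h1, two_smul]
    · simp only [G, if_pos h.le, if_neg h.not_ge, MatrixMeasure.herglotzCoeff,
        if_neg (Nat.sub_pos_of_lt h).ne', Nat.cast_sub h.le, zero_add, conjTranspose_smul,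
        hM.moment_neg, conjTranspose_conjTranspose, hs]
  have hcoeff (i : ℕ) (hi : i ∈ Finset.range (N + 1)) : coeff i (mk M.herglotzCoeff * p) =
      ∑ b ∈ Finset.range (N + 1), G i b * coeff b p := by
    rw [coeff_mul, ← Finset.Nat.sum_antidiagonal_swap,
      Finset.Nat.sum_antidiagonal_eq_sum_range_succ_mk]
    have hsub : Finset.range (i + 1) ⊆ Finset.range (N + 1) :=
      Finset.range_mono (Nat.succ_le_of_lt (Finset.mem_range.1 hi))
    rw [← Finset.sum_subset hsub]
    · refine Finset.sum_congr rfl fun b hb => ?_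
      have hb : b ≤ i := Nat.lt_succ_iff.1 (Finset.mem_range.1 hb)
      simp [G, hb]
    · intro b _ hb
      have hb : ¬ b ≤ i := fun h => hb (Finset.mem_range.2 (Nat.lt_succ_of_le h))
      simp [G, hb]
  rw [M.sandwich_polyValue _ (natDegree_trunc_lt p N)]
  have hS : ∑ i ∈ Finset.range (N + 1), (coeff i p)ᴴ * coeff i (mk M.herglotzCoeff * p) =
      ∑ i ∈ Finset.range (N + 1), ∑ b ∈ Finset.range (N + 1),
        (coeff i p)ᴴ * G i b * coeff b p := by
    refine Finset.sum_congr rfl fun i hi => ?_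
    rw [hcoeff i hi, Finset.mul_sum]
    simp only [Matrix.mul_assoc]
  rw [hS]
  have hT : (∑ i ∈ Finset.range (N + 1), ∑ b ∈ Finset.range (N + 1),
        (coeff i p)ᴴ * G i b * coeff b p)ᴴ = ∑ i ∈ Finset.range (N + 1),
        ∑ b ∈ Finset.range (N + 1), (coeff i p)ᴴ * (G b i)ᴴ * coeff b p := by
    rw [Finset.sum_comm]
    simp only [conjTranspose_sum, conjTranspose_mul, conjTranspose_conjTranspose,
      Matrix.mul_assoc]
  rw [hT, ← Finset.sum_add_distrib, Finset.smul_sum]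
  refine Finset.sum_congr rfl fun i hi => ?_
  rw [← Finset.sum_add_distrib, Finset.smul_sum]
  refine Finset.sum_congr rfl fun b hb => ?_
  rw [coeff_trunc, coeff_trunc, if_pos (Finset.mem_range.1 hi), if_pos (Finset.mem_range.1 hb),
    ← add_mul, ← mul_add, hG]
  simp

variable (h1 : M Set.univ = 1) (hM : M.IsPositive) (hnt : M.IsNontrivial)
include h1 hM hnt

/-- On the graph of the Schur function, the trace of the indefinite form is the squared norm in
`L²(M)` of the polynomial `p - z q`. Indeed `F (p - z q) = p + z q` up to terms of higher order than
the degree of `p - z q`, which the pairing does not see. -/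
theorem IsGraphPair.trace_gramDiff_pos {N : ℕ} {p q : PowerSeries (Matrix (Fin d) (Fin d) ℂ)}
    (h : IsGraphPair (taylorSeries (schurFunction M)) N p q) :
    0 < (gramDiff N p q).trace.re := by
  set φ := taylorSeries (schurFunction M) with hφ
  set F := taylorSeries M.herglotz with hF
  have hFφ : F * (1 - X * φ) = 1 + X * φ := taylorSeries_herglotz_mul h1 hM hnt
  have hXq (i : ℕ) (hi : N + 1 ≤ i) : coeff i (X * q) = 0 := by
    obtain ⟨k, rfl⟩ : ∃ k, i = k + 1 := ⟨i - 1, by omega⟩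
    rw [coeff_succ_X_mul, h.right_eq_zero k (by omega)]
  have hFp : F * (p - X * q) = p + X * q + (1 + F) * (X * (φ * p - q)) := by
    calc F * (p - X * q) = F * (1 - X * φ) * p + F * (X * (φ * p - q)) := by noncomm_ring
      _ = _ := by rw [hFφ]; noncomm_ring
  have hz : ∀ j < N, coeff j (φ * p - q) = 0 := fun j hj => by
    rw [map_sub, h.graph j hj, sub_self]
  have hcoeff (i : ℕ) (hi : i ∈ Finset.range (N + 1)) :
      coeff i (F * (p - X * q)) = coeff i p + coeff i (X * q) := by
    rw [hFp, map_add, map_add, coeff_mul_eq_zero_of_lt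
      (fun j hj => coeff_X_mul_eq_zero_of_lt hz hj) _ (Finset.mem_range.1 hi), add_zero]
  have hne : trunc (N + 1) (p - X * q) ≠ 0 := by
    intro h0
    refine h.ne_C_mul_X_mul 1 ?_
    rw [map_one, one_mul, ← sub_eq_zero]
    ext1 i
    rcases lt_or_ge i (N + 1) with hi | hi
    · have := congrArg (fun P => Polynomial.coeff P i) h0
      simpa only [coeff_trunc, if_pos hi, Polynomial.coeff_zero, map_zero] using this
    · rw [map_sub, h.left_eq_zero i (by omega), hXq i hi, sub_zero, map_zero]
  have hpos := hnt.trace_sandwich_pos hne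
  have h2 := congrArg (fun A => A.trace.re) (two_smul_sandwich h1 hM (N := N) (p - X * q))
  rw [← taylorSeries_herglotz h1] at h2
  simp only [trace_smul, trace_add, trace_conjTranspose, smul_eq_mul, Complex.add_re,
    Complex.star_def, Complex.conj_re, Complex.mul_re, Complex.re_ofNat, Complex.im_ofNat,
    zero_mul, sub_zero] at h2
  have h3 : (∑ i ∈ Finset.range (N + 1), (coeff i (p - X * q))ᴴ *
      coeff i (F * (p - X * q))).trace.re = (gramDiff N p q).trace.re := by
    rw [← gramDiff_X_mul (h.left_eq_zero N le_rfl), gramDiff, trace_sum, trace_sum,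
      Complex.re_sum, Complex.re_sum]
    refine Finset.sum_congr rfl fun i hi => ?_
    rw [hcoeff i hi, map_sub]
    generalize coeff i p = a
    generalize coeff i (X * q) = b
    -- the cross terms `a^* b` and `b^* a` have traces with equal real parts
    have hab : (aᴴ * b).trace.re = (bᴴ * a).trace.re := by
      have : (bᴴ * a) = (aᴴ * b)ᴴ := by rw [conjTranspose_mul, conjTranspose_conjTranspose]
      rw [this, trace_conjTranspose, Complex.star_def, Complex.conj_re]
    have : (a - b)ᴴ * (a + b) = aᴴ * a - bᴴ * b + (aᴴ * b - bᴴ * a) := by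
      rw [conjTranspose_sub]; noncomm_ring
    rw [this, trace_add, Complex.add_re, trace_sub (aᴴ * b), Complex.sub_re, hab, sub_self,
      add_zero]
  rw [h3] at h2
  linarith

open scoped Matrix.Norms.L2Operator in
theorem analyticAt_schurIterate {n : ℕ}
    (hn : ∀ m < n, (1 - (verblunsky M m)ᴴ * verblunsky M m).PosDef) :
    ∀ j ≤ n, AnalyticAt ℂ (schurIterate M j) 0 := by
  intro j
  induction j with
  | zero => exact fun _ => analyticAt_schurFunction h1 hM hnt (by simp)
  | succ j ih => exact fun hj => AnalyticAt.schurStep (ih (by omega)) (hn j (by omega))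

/-- The indefinite form is positive on the graph of every Schur iterate reached so far, by descent
to the Schur function itself. -/
theorem IsGraphPair.trace_gramDiff_pos_of_schurIterate {n : ℕ}
    (hn : ∀ m < n, (1 - (verblunsky M m)ᴴ * verblunsky M m).PosDef) :
    ∀ j ≤ n, ∀ {N : ℕ} {p q : PowerSeries (Matrix (Fin d) (Fin d) ℂ)},
      IsGraphPair (taylorSeries (schurIterate M j)) N p q → 0 < (gramDiff N p q).trace.re := by
  intro j
  induction j with
  | zero => exact fun _ _ _ _ h => h.trace_gramDiff_pos h1 hM hnt
  | succ j ih =>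
    intro hj N p q h
    have hj' := hn j (by omega)
    obtain ⟨h', e⟩ := h.descend hj'
      (taylorSeries_schurStep (analyticAt_schurIterate h1 hM hnt hn j (by omega)) hj')
    rw [← e]
    exact ih (by omega) h'

/-- The Verblunsky coefficients are strict contractions: the constants `V` and `α_n V` form a pair on
the graph of `f_n` up to order `1`, with indefinite form `V^* (1 - α_n^* α_n) V`. -/
theorem posDef_one_sub_verblunsky (n : ℕ) :
    (1 - (verblunsky M n)ᴴ * verblunsky M n).PosDef := by
  induction n using Nat.strong_induction_on with
  | _ n ih =>
    refine posDef_of_trace_pos (by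
      simp [IsHermitian, conjTranspose_sub, conjTranspose_mul]) fun V hV => ?_
    have hpair : IsGraphPair (taylorSeries (schurIterate M n)) 1 (C V) (C (verblunsky M n * V)) := by
      refine ⟨fun i hi => ?_, fun i hi => ?_, fun h0 => hV ?_, fun i hi => ?_⟩
      · rw [coeff_C, if_neg (by omega)]
      · rw [coeff_C, if_neg (by omega)]
      · simpa using congrArg (coeff 0) h0
      · obtain rfl : i = 0 := by omega
        rw [coeff_mul_C, coeff_taylorSeries, taylorCoeff_zero, coeff_C, if_pos rfl]
        rfl
    have := hpair.trace_gramDiff_pos_of_schurIterate h1 hM hnt ih n le_rfl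
    convert this using 3
    rw [gramDiff, Finset.sum_range_one, coeff_C, if_pos rfl, coeff_C, if_pos rfl,
      conjTranspose_mul]
    noncomm_ring

end Nondegenerate

/-! ### The Schur recurrences -/

section Recurrence

open scoped Matrix.Norms.L2Operator in
open PowerSeries in
/-- The Taylor coefficients of a function in terms of those of its Schur transform and of its own
coefficients of lower order. -/
theorem taylorCoeff_succ {d : ℕ} {g : ℂ → Matrix (Fin d) (Fin d) ℂ} (hg : AnalyticAt ℂ g 0)
    (hα : (1 - (g 0)ᴴ * g 0).PosDef) (k : ℕ) :
    taylorCoeff g (k + 1) = defectR (g 0) * taylorCoeff (schurStep g) k * defectL (g 0) -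
      ∑ j ∈ Finset.range k, taylorCoeff g (j + 1) * (g 0)ᴴ * (defectR (g 0))⁻¹ *
        taylorCoeff (schurStep g) (k - (j + 1)) * defectL (g 0) := by
  have h := congrArg (coeff (k + 1)) (taylorSeries_schurStep hg hα)
  rw [map_sub, coeff_C, if_neg (Nat.succ_ne_zero k), sub_zero, coeff_taylorSeries, coeff_mul_C,
    X_mul, ← mul_assoc, coeff_succ_mul_X, coeff_mul,
    Finset.Nat.sum_antidiagonal_eq_sum_range_succ_mk, Finset.sum_range_succ'] at h
  have e0 : (1 - g 0 * (g 0)ᴴ) * (defectR (g 0))⁻¹ = defectR (g 0) := by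
    rw [← defectR_mul_self hα, Matrix.mul_assoc, defectR_mul_inv hα, Matrix.mul_one]
  simp only [coeff_mul_C, map_sub, coeff_one, Nat.succ_ne_zero, if_false, if_true, zero_sub,
    coeff_taylorSeries, taylorCoeff_zero, e0, Nat.sub_zero] at h
  rw [h, add_mul, Finset.sum_mul, add_comm, sub_eq_add_neg, ← Finset.sum_neg_distrib]
  simp only [neg_mul]

variable {d : ℕ}

/-- The leading term `ρ_n^R ⋯ ρ_{n+k-1}^R α_{n+k} ρ_{n+k-1}^L ⋯ ρ_n^L` of the `k`-th Taylor
coefficient of the `n`-th Schur iterate. -/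
noncomputable def leadingTerm (M : MatrixMeasure d) (n k : ℕ) : Matrix (Fin d) (Fin d) ℂ :=
  ((List.range k).map fun i => rhoR M (n + i)).prod * verblunsky M (n + k) *
    ((List.range k).reverse.map fun i => rhoL M (n + i)).prod

theorem leadingTerm_zero (M : MatrixMeasure d) (n : ℕ) : leadingTerm M n 0 = verblunsky M n := by
  simp [leadingTerm]

theorem leadingTerm_succ (M : MatrixMeasure d) (n k : ℕ) :
    leadingTerm M n (k + 1) = rhoR M n * leadingTerm M (n + 1) k * rhoL M n := by
  have e {β : Type} (f : ℕ → β) : (List.range (k + 1)).map (fun i => f (n + i)) =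
      f n :: (List.range k).map fun i => f (n + 1 + i) := by
    rw [List.range_succ_eq_map, List.map_cons, List.map_map]
    congr 2
    ext i
    exact congrArg f (by simp only [Nat.succ_eq_add_one]; omega)
  rw [leadingTerm, leadingTerm, List.map_reverse, List.map_reverse, e, e (rhoL M),
    List.reverse_cons, List.prod_append, List.prod_cons, List.prod_singleton, Nat.add_assoc n 1 k,
    Nat.add_comm 1 k]
  simp only [Matrix.mul_assoc]

/-- The standing assumptions on a matrix measure: positive, normalized and non-trivial. -/
structure IsAdmissible (M : MatrixMeasure d) : Prop where
  isPositive : M.IsPositive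
  apply_univ : M Set.univ = 1
  isNontrivial : M.IsNontrivial

/-- A matrix attached to every admissible measure, of any size, is rational in the first `m` sets
of letters if one noncommutative rational expression computes it for all measures; the expression
is required to be defined wherever the letters `ρ_j^R` are invertible. -/
def IsNCRational (m : ℕ) (v : ∀ d, MatrixMeasure d → Matrix (Fin d) (Fin d) ℂ) : Prop :=
  ∃ E : NCRatExpr (Letter m),
    (∀ (d : ℕ) (X : Letter m → Matrix (Fin d) (Fin d) ℂ), (∀ j, IsUnit (X (.rhoR j))) →
      E.DefinedAt X) ∧
    ∀ (d : ℕ) (M : MatrixMeasure d), IsAdmissible M → E.eval (letterValue M) = v d M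

namespace IsNCRational

variable {m : ℕ} {v w : ∀ d, MatrixMeasure d → Matrix (Fin d) (Fin d) ℂ}

theorem congr (hv : IsNCRational m v)
    (h : ∀ (d : ℕ) (M : MatrixMeasure d), IsAdmissible M → w d M = v d M) : IsNCRational m w := by
  obtain ⟨E, h1, h2⟩ := hv
  exact ⟨E, h1, fun d M hM => (h2 d M hM).trans (h d M hM).symm⟩

theorem const (c : ℂ) : IsNCRational m fun _ _ => c • 1 :=
  ⟨.const c, fun _ _ _ => trivial, fun _ _ _ => rfl⟩

theorem var (x : Letter m) : IsNCRational m fun _ M => letterValue M x :=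
  ⟨.var x, fun _ _ _ => trivial, fun _ _ _ => rfl⟩

theorem inv_rhoR {n : ℕ} (hn : n < m) : IsNCRational m fun _ M => (rhoR M n)⁻¹ :=
  ⟨.inv (.var (.rhoR ⟨n, hn⟩)), fun _ _ h => ⟨trivial, h _⟩, fun _ _ _ => rfl⟩

theorem add (hv : IsNCRational m v) (hw : IsNCRational m w) :
    IsNCRational m fun d M => v d M + w d M := by
  obtain ⟨E, h1, h2⟩ := hv
  obtain ⟨E', h1', h2'⟩ := hw
  exact ⟨.add E E', fun d X h => ⟨h1 d X h, h1' d X h⟩,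
    fun d M hM => congrArg₂ (· + ·) (h2 d M hM) (h2' d M hM)⟩

theorem mul (hv : IsNCRational m v) (hw : IsNCRational m w) :
    IsNCRational m fun d M => v d M * w d M := by
  obtain ⟨E, h1, h2⟩ := hv
  obtain ⟨E', h1', h2'⟩ := hw
  exact ⟨.mul E E', fun d X h => ⟨h1 d X h, h1' d X h⟩,
    fun d M hM => congrArg₂ (· * ·) (h2 d M hM) (h2' d M hM)⟩

theorem sub (hv : IsNCRational m v) (hw : IsNCRational m w) :
    IsNCRational m fun d M => v d M - w d M :=
  (hv.add ((const (-1)).mul hw)).congr fun d M _ => by simp [sub_eq_add_neg]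

theorem sum {u : ℕ → ∀ d, MatrixMeasure d → Matrix (Fin d) (Fin d) ℂ} (k : ℕ)
    (hu : ∀ j < k, IsNCRational m (u j)) :
    IsNCRational m fun d M => ∑ j ∈ Finset.range k, u j d M := by
  induction k with
  | zero => exact (const 0).congr fun d M _ => by simp
  | succ k ih =>
    exact ((ih fun j hj => hu j (by omega)).add (hu k (Nat.lt_succ_self k))).congr fun d M _ =>
      Finset.sum_range_succ _ _

theorem leadingTerm {n k : ℕ} (h : n + k < m) : IsNCRational m fun _ M => leadingTerm M n k := by
  induction k generalizing n with
  | zero => exact (var (.alpha ⟨n, h⟩)).congr fun d M _ => leadingTerm_zero M n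
  | succ k ih =>
    have hn : n < m := by omega
    exact (((var (.rhoR ⟨n, hn⟩)).mul (ih (n := n + 1) (by omega))).mul
      (var (.rhoL ⟨n, hn⟩))).congr fun d M _ => leadingTerm_succ M n k

end IsNCRational

theorem taylorCoeff_schurIterate_succ {M : MatrixMeasure d} (hM : IsAdmissible M) (n k : ℕ) :
    taylorCoeff (schurIterate M n) (k + 1) =
      rhoR M n * taylorCoeff (schurIterate M (n + 1)) k * rhoL M n -
      ∑ j ∈ Finset.range k, taylorCoeff (schurIterate M n) (j + 1) * (verblunsky M n)ᴴ *
        (rhoR M n)⁻¹ * taylorCoeff (schurIterate M (n + 1)) (k - (j + 1)) * rhoL M n := by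
  have hpd := posDef_one_sub_verblunsky hM.apply_univ hM.isPositive hM.isNontrivial
  exact taylorCoeff_succ (analyticAt_schurIterate hM.apply_univ hM.isPositive hM.isNontrivial
    (fun m _ => hpd m) n le_rfl) (hpd n) k

/-- The Taylor coefficients of the Schur iterates are their leading terms up to a noncommutative
rational function of the earlier Verblunsky coefficients and defects. -/
theorem isNCRational_taylorCoeff_sub_leadingTerm (k : ℕ) : ∀ {n m : ℕ}, n + k ≤ m →
    IsNCRational m fun _ M => taylorCoeff (schurIterate M n) k - leadingTerm M n k := by
  induction k using Nat.strong_induction_on with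
  | _ k ih =>
    intro n m hm
    have hfull {i l : ℕ} (hi : i < k) (hl : l + i < m) :
        IsNCRational m fun _ M => taylorCoeff (schurIterate M l) i :=
      ((ih i hi hl.le).add (.leadingTerm hl)).congr fun d M _ => (sub_add_cancel _ _).symm
    cases k with
    | zero =>
      refine (IsNCRational.const 0).congr fun d M _ => ?_
      rw [taylorCoeff_zero, leadingTerm_zero, zero_smul]
      exact sub_self _
    | succ k =>
      have hn : n < m := by omega
      have hmain := ((IsNCRational.var (.rhoR ⟨n, hn⟩)).mul
        (ih k (Nat.lt_succ_self k) (by omega : n + 1 + k ≤ m))).mul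
        (IsNCRational.var (.rhoL ⟨n, hn⟩))
      have hrest := IsNCRational.sum k fun j hj =>
        ((((hfull (i := j + 1) (l := n) (by omega) (by omega)).mul
          (.var (.alphaStar ⟨n, hn⟩))).mul (.inv_rhoR hn)).mul
          (hfull (i := k - (j + 1)) (l := n + 1) (by omega) (by omega))).mul
          (.var (.rhoL ⟨n, hn⟩))
      refine (hmain.sub hrest).congr fun d M hM => ?_
      rw [taylorCoeff_schurIterate_succ hM, leadingTerm_succ]
      simp only [letterValue, mul_sub, sub_mul]
      abel

end Recurrence

end MatrixSchur

theorem mainTheorem1 :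
    ∃ R : (k : ℕ) → MatrixSchur.NCRatExpr (MatrixSchur.Letter k),
      (∀ k : ℕ, (R k).Nondegenerate) ∧
      ∀ (d : ℕ) (M : MatrixSchur.MatrixMeasure d),
        M.IsPositive → M Set.univ = 1 → M.IsNontrivial →
        -- the Schur function is a Schur function, related to `F` as it should be, and the sum of
        -- its Taylor series
        (∀ z : ℂ, ‖z‖ < 1 →
          (1 - (MatrixSchur.schurFunction M z)ᴴ * MatrixSchur.schurFunction M z).PosSemidef ∧
          IsUnit (1 - z • MatrixSchur.schurFunction M z) ∧
          M.herglotz z =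
            (1 + z • MatrixSchur.schurFunction M z) *
              (1 - z • MatrixSchur.schurFunction M z)⁻¹ ∧
          HasSum (fun k : ℕ => z ^ k • MatrixSchur.taylorCoeff (MatrixSchur.schurFunction M) k)
            (MatrixSchur.schurFunction M z)) ∧
        -- the defect matrices are positive definite square roots
        (∀ n : ℕ,
          (MatrixSchur.rhoL M n).PosDef ∧
          MatrixSchur.rhoL M n ^ 2 =
            1 - (MatrixSchur.verblunsky M n)ᴴ * MatrixSchur.verblunsky M n ∧
          (MatrixSchur.rhoR M n).PosDef ∧
          MatrixSchur.rhoR M n ^ 2 =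
            1 - MatrixSchur.verblunsky M n * (MatrixSchur.verblunsky M n)ᴴ) ∧
        -- the matrix Schur recurrences
        ∀ k : ℕ,
          (R k).DefinedAt (MatrixSchur.letterValue M) ∧
          MatrixSchur.taylorCoeff (MatrixSchur.schurFunction M) k =
            ((List.range k).map (MatrixSchur.rhoR M)).prod * MatrixSchur.verblunsky M k *
                ((List.range k).reverse.map (MatrixSchur.rhoL M)).prod +
              (R k).eval (MatrixSchur.letterValue M) := by
  choose R hdef heval using fun k =>
    MatrixSchur.isNCRational_taylorCoeff_sub_leadingTerm k (n := 0) (m := k) (by omega)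
  refine ⟨R, fun k => ⟨1, fun _ => 1, one_pos, hdef k 1 _ fun _ => isUnit_one⟩,
    fun d M hM h1 hnt => ?_⟩
  have hpd := MatrixSchur.posDef_one_sub_verblunsky h1 hM hnt
  refine ⟨fun z hz => ⟨?_, ?_, ?_, ?_⟩, fun n => ⟨?_, ?_, ?_, ?_⟩, fun k => ⟨?_, ?_⟩⟩
  · exact MatrixSchur.norm_le_one_iff_posSemidef.1 (MatrixSchur.norm_schurFunction_le h1 hM hnt hz)
  · exact MatrixSchur.isUnit_one_sub_smul_schurFunction h1 hM hnt hz
  · exact MatrixSchur.herglotz_eq h1 hM hnt hz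
  · exact MatrixSchur.hasSum_schurFunction h1 hM hnt hz
  · exact MatrixSchur.posDef_defectL (hpd n)
  · rw [sq]
    exact MatrixSchur.defectL_mul_self (hpd n)
  · exact MatrixSchur.posDef_defectR (hpd n)
  · rw [sq]
    exact MatrixSchur.defectR_mul_self (hpd n)
  · exact hdef k d _ fun j => (MatrixSchur.posDef_defectR (hpd j)).isUnit
  · rw [heval k d M ⟨hM, h1, hnt⟩]
    simp only [MatrixSchur.leadingTerm, zero_add]
    exact (add_sub_cancel _ _).symm
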